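/- **Lemma (Symmetry reduction).** All quantum systems are finite-dimensional (and nonzero). $\mathscr D(\mathcal H)$ denotes the density operators on $\mathcal H$, and $\mathrm{PERM}(\mathcal H^{\otimes n})\subseteq\mathscr D(\mathcal H^{\otimes n})$ those that are invariant under conjugation with the unitaries permuting the $n$ tensor factors. A *quantum divergence* $\mathbf D(\cdot\|\cdot)$ assigns to every density operator $\rho$ and positive semidefinite operator $\sigma$ on a common system a value in $\mathbb R\cup\{+\infty\}$ such that $\mathbf D(\mathcal E(\rho)\|\mathcal E(\sigma))\le \mathbf D(\rho\|\sigma)$ for every completely positive trace preserving (CPTP) map $\mathcal E$. It has the *direct-sum property* if $$\mathbf D\Big(\sum_x p(x)\,|x\rangle\langle x|\otimes\rho^{(x)}\,\Big\|\,\sum_x p(x)\,|x\rangle\langle x|\otimes\sigma^{(x)}\Big)=\sum_x p(x)\,\mathbf D(\rho^{(x)}\|\sigma^{(x)})$$ for every probability distribution $p$ on a finite set, density operators $\rho^{(x)}$ and positive semidefinite operators $\sigma^{(x)}$ (with $0\cdot\infty=0$). It is lower semicontinuous if on each system it is jointly lower semicontinuous in $(\rho,\sigma)$. For a CPTP map $\mathcal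 N$ and a completely positive (CP) map $\mathcal M$ from $AE$ to $B$, the *minimax channel divergence* is $$\mathbf D^{\mathrm{mx}}(\mathcal N\|\mathcal M):=\sup_{\rho_{AR}\in\mathscr D(\mathcal H_A\otimes\mathcal H_R)}\ \inf_{\sigma_E,\omega_E\in\mathscr D(\mathcal H_E)}\mathbf D\big(\mathcal N_{AE\to B}(\rho_{AR}\otimes\sigma_E)\,\big\|\,\mathcal M_{AE\to B}(\rho_{AR}\otimes\omega_E)\big),$$ where the supremum also runs over reference systems $R$ of arbitrary finite dimension, on which the maps act as the identity. Let $\mathbf D$ be a lower semicontinuous quantum divergence with the direct-sum property, and let $A$, $B$, $E$ be quantum systems. Then for all $\mathcal N\in\mathrm{CPTP}(AE:B)$, $\mathcal M\in\mathrm{CP}(AE:B)$ and every integer $n\ge 2$, $$\begin{aligned}\mathbf D^{\mathrm{mx}}(\mathcal N^{\otimes n}\|\mathcal M^{\otimes n}) &=\inf_{\sigma,\omega\in\mathrm{PERM}(\mathcal H_E^{\otimes n})}\ \sup_{\rho\in\mathscr D(\mathcal H_A^{\otimes n})}\mathbf D\big(\mathcal N^{\otimes n}(|\psi_\rho\rangle\langle\psi_\rho|\otimes\sigma)\,\big\|\,\mathcal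 M^{\otimes n}(|\psi_\rho\rangle\langle\psi_\rho|\otimes\omega)\big)\\ &=\inf_{\sigma,\omega\in\mathrm{PERM}(\mathcal H_E^{\otimes n})}\ \sup_{\rho\in\mathrm{PERM}(\mathcal H_A^{\otimes n})}\mathbf D\big(\mathcal N^{\otimes n}(|\psi_\rho\rangle\langle\psi_\rho|\otimes\sigma)\,\big\|\,\mathcal M^{\otimes n}(|\psi_\rho\rangle\langle\psi_\rho|\otimes\omega)\big),\end{aligned}$$ where, for each $\rho\in\mathscr D(\mathcal H_A^{\otimes n})$, $|\psi_\rho\rangle\in\mathcal H_A^{\otimes n}\otimes\mathcal H_{R}^{\otimes n}$ with $\mathcal H_R=\mathcal H_A$ is an arbitrary purification of $\rho$. -/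

import Mathlib

open scoped Kronecker ComplexOrder

universe u v w x

namespace QuantumJammer

/-! Finite-dimensional quantum systems are given by finite index types `a`, with state space `ℂ^a`
and operators `Matrix a a ℂ`. The joint system of `a` and `b` is `a × b`; `n` copies of `a` form the
system `Fin n → a`, whose indices label the product basis of the `n`-fold tensor power. -/

/-- Density operators: positive semidefinite, trace one. -/
def IsDensity {a : Type u} [Fintype a] (ρ : Matrix a a ℂ) : Prop :=
  ρ.PosSemidef ∧ ρ.trace = 1

/-- The set of density operators of a system. -/
abbrev Density (a : Type u) [Fintype a] : Type u := {ρ : Matrix a a ℂ // IsDensity ρ}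

/-- `Φ` acting on `A`, tensored with the identity map on the operators of `R`. -/
def tensorId {a : Type u} {b : Type v} (Φ : Matrix a a ℂ →ₗ[ℂ] Matrix b b ℂ) (r : Type w) :
    Matrix (a × r) (a × r) ℂ →ₗ[ℂ] Matrix (b × r) (b × r) ℂ where
  toFun X := Matrix.of fun i j => Φ (Matrix.of fun p q => X (p, i.2) (q, j.2)) i.1 j.1
  map_add' X Y := by
    ext i j
    exact congrFun (congrFun (Φ.map_add (Matrix.of fun p q => X (p, i.2) (q, j.2))
      (Matrix.of fun p q => Y (p, i.2) (q, j.2))) i.1) j.1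
  map_smul' c X := by
    ext i j
    exact congrFun (congrFun (Φ.map_smul c (Matrix.of fun p q => X (p, i.2) (q, j.2))) i.1) j.1

/-- Completely positive maps: tensored with the identity on an ancilla of any finite dimension,
they preserve positive semidefiniteness. -/
def IsCP {a : Type u} {b : Type v} [Fintype a] [Fintype b]
    (Φ : Matrix a a ℂ →ₗ[ℂ] Matrix b b ℂ) : Prop :=
  ∀ (k : ℕ) (X : Matrix (a × Fin k) (a × Fin k) ℂ),
    X.PosSemidef → (tensorId Φ (Fin k) X).PosSemidef

/-- Quantum channels: completely positive and trace preserving maps. -/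
def IsCPTP {a : Type u} {b : Type v} [Fintype a] [Fintype b]
    (Φ : Matrix a a ℂ →ₗ[ℂ] Matrix b b ℂ) : Prop :=
  IsCP Φ ∧ ∀ X : Matrix a a ℂ, (Φ X).trace = X.trace

/-- A functional of two operators on a common (arbitrary finite-dimensional) system, with values in
the extended reals. Only its values at pairs (density operator, positive semidefinite operator)
matter. -/
abbrev OperatorFunctional : Type (u + 1) :=
  ∀ (a : Type u) [Fintype a], Matrix a a ℂ → Matrix a a ℂ → EReal

/-- Quantum divergences: functionals on pairs (density operator, positive semidefinite operator)
with values in `ℝ ∪ {+∞}` that satisfy the data-processing inequality. -/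
structure IsQuantumDivergence (D : OperatorFunctional.{u}) : Prop where
  ne_bot : ∀ (a : Type u) [Fintype a] (ρ σ : Matrix a a ℂ),
    IsDensity ρ → σ.PosSemidef → D a ρ σ ≠ ⊥
  data_processing : ∀ (a b : Type u) [Fintype a] [Fintype b]
    (Φ : Matrix a a ℂ →ₗ[ℂ] Matrix b b ℂ), IsCPTP Φ →
    ∀ ρ σ : Matrix a a ℂ, IsDensity ρ → σ.PosSemidef → D b (Φ ρ) (Φ σ) ≤ D a ρ σ

/-- Joint lower semicontinuity on every (finite-dimensional) system. -/
def IsLowerSemicontinuous (D : OperatorFunctional.{u}) : Prop :=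
  ∀ (a : Type u) [Fintype a],
    LowerSemicontinuousOn (fun p : Matrix a a ℂ × Matrix a a ℂ => D a p.1 p.2)
      {p | IsDensity p.1 ∧ p.2.PosSemidef}

/-- The classical-quantum operator `∑ x, p(x) |x⟩⟨x| ⊗ τ x`. -/
noncomputable def cqOperator {a : Type u} {k : ℕ} (p : Fin k → ℝ)
    (τ : Fin k → Matrix a a ℂ) : Matrix (Fin k × a) (Fin k × a) ℂ :=
  ∑ x, (p x : ℂ) • (Matrix.single x x (1 : ℂ) ⊗ₖ τ x)

/-- The direct-sum property. Here `0 * ⊤ = 0`, so outcomes of probability zero do not count. -/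
def HasDirectSumProperty (D : OperatorFunctional.{u}) : Prop :=
  ∀ (a : Type u) [Fintype a] (k : ℕ) (p : Fin k → ℝ) (ρ σ : Fin k → Matrix a a ℂ),
    (∀ x, 0 ≤ p x) → ∑ x, p x = 1 → (∀ x, IsDensity (ρ x)) → (∀ x, (σ x).PosSemidef) →
    D (Fin k × a) (cqOperator p ρ) (cqOperator p σ) = ∑ x, (p x : EReal) * D a (ρ x) (σ x)

/-- `N_{AE → B}(ρ_{AR} ⊗ σ_E)`, an operator on `BR`; the identity acts on the reference `R`. -/
noncomputable def jammedOutput {a : Type u} {e : Type v} {b : Type w} {r : Type x}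
    (N : Matrix (a × e) (a × e) ℂ →ₗ[ℂ] Matrix b b ℂ)
    (ρ : Matrix (a × r) (a × r) ℂ) (σ : Matrix e e ℂ) : Matrix (b × r) (b × r) ℂ :=
  tensorId N r ((ρ ⊗ₖ σ).submatrix (fun i : (a × e) × r => ((i.1.1, i.2), i.1.2))
    (fun i : (a × e) × r => ((i.1.1, i.2), i.1.2)))

/-- The minimax channel divergence: supremum over the input states `ρ_{AR}` (with a reference of
arbitrary finite dimension) of the infimum over the jammer states `σ_E`, `ω_E`. -/
noncomputable def minimaxDiv (D : OperatorFunctional.{u}) {a e b : Type u}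
    [Fintype a] [Fintype e] [Fintype b]
    (N M : Matrix (a × e) (a × e) ℂ →ₗ[ℂ] Matrix b b ℂ) : EReal :=
  ⨆ (k : ℕ) (ρ : Density (a × Fin k)), ⨅ (σ : Density e) (ω : Density e),
    D (b × Fin k) (jammedOutput N ρ.1 σ.1) (jammedOutput M ρ.1 ω.1)

/-- The `n`-fold tensor power `N^{⊗ n}` of `N_{AE → B}`, with the inputs grouped as `A^n` and `E^n`,
given by its values on matrix units (`X` is the sum of `X p q` times the matrix unit `(p, q)`). -/
noncomputable def tensorPower {a e b : Type u} [Fintype a] [Fintype e]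
    [DecidableEq a] [DecidableEq e] (n : ℕ)
    (N : Matrix (a × e) (a × e) ℂ →ₗ[ℂ] Matrix b b ℂ) :
    Matrix ((Fin n → a) × (Fin n → e)) ((Fin n → a) × (Fin n → e)) ℂ →ₗ[ℂ]
      Matrix (Fin n → b) (Fin n → b) ℂ where
  toFun X := Matrix.of fun i j => ∑ p, ∑ q, X p q *
    ∏ m, N (Matrix.single (p.1 m, p.2 m) (q.1 m, q.2 m) 1) (i m) (j m)
  map_add' X Y := by
    ext i j
    simp [add_mul, Finset.sum_add_distrib]
  map_smul' c X := by
    ext i j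
    simp [Finset.mul_sum, mul_assoc]

/-- Invariance under conjugation with the unitaries that permute the `n` tensor factors. -/
def IsPermInvariant {a : Type u} {n : ℕ} (ρ : Matrix (Fin n → a) (Fin n → a) ℂ) : Prop :=
  ∀ π : Equiv.Perm (Fin n), ρ.submatrix (fun s => s ∘ π) (fun s => s ∘ π) = ρ

/-- The permutation-invariant density operators on `n` copies of a system. -/
abbrev PermDensity (a : Type u) [Fintype a] (n : ℕ) : Type u :=
  {ρ : Density (Fin n → a) // IsPermInvariant ρ.1}

/-- The rank-one operator `|ψ⟩⟨ψ|`. -/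
def ketbra {a : Type u} (ψ : a → ℂ) : Matrix a a ℂ := Matrix.vecMulVec ψ (star ψ)

/-- The vector `ψ` of `AR` purifies `ρ_A`: the partial trace of `|ψ⟩⟨ψ|` over `R` is `ρ`. -/
def IsPurification {a : Type u} {r : Type v} [Fintype r] (ψ : a × r → ℂ)
    (ρ : Matrix a a ℂ) : Prop :=
  ∀ i j, ∑ k, ketbra ψ (i, k) (j, k) = ρ i j

end QuantumJammer

open QuantumJammer

/-!
The theorem combines a minimax theorem with three properties of
`jammedDiv D N M ρ σ ω = D(N(ρ_{AR} ⊗ σ_E) ‖ M(ρ_{AR} ⊗ ω_E))`.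

* Purifications are optimal inputs (`jammedDiv_le_purification`): a state `ρ_{AR}` is obtained from
  any purification of `ρ_A` by a channel on the purifying system
  (`exists_krausMap_purification`), and such a channel commutes with `N` and `M`, so that data
  processing applies.
* A classical register in the reference averages (`jammedDiv_flaggedState`): by the direct-sum
  property, the input `∑ x, p(x) |x⟩⟨x| ⊗ ρ x` has divergence `∑ x, p(x) jammedDiv D N M (ρ x) σ ω`.
  With the first property this gives concavity in the marginal on `A`; data processing for the
  partial trace over the register gives joint convexity in the jammer states (`jammedDiv_sum_le`).
* Recording a random permutation of the input symmetrizes the jammer (`jammedDiv_symmetrize_le`):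
  tensor powers are permutation covariant, so `permFlagged ρ` against `σ`, `ω` is at least as good
  as `ρ` against the symmetrized `σ`, `ω`. The marginal of `permFlagged ρ` on `A^n` is permutation
  invariant.

Write `R₁` and `R₂` for the two infima, with `ρ` ranging over all and over the permutation-invariant
states. For permutation-invariant `σ`, `ω`, an arbitrary input `ρ_{AR}` is dominated by
`permFlagged ρ`, hence by the purification of its permutation-invariant marginal, so the minimax
divergence is at most `R₂`. Clearly `R₂ ≤ R₁`. The permutation-invariant states form a compact
convex set, so infimum and supremum in `R₁` can be exchanged
(`iInf_iSup_jammedDiv_le_iSup_iInf`), and for each `ρ` the infimum over permutation-invariant jammer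
states is at most the one that `permFlagged` of the purification allows against arbitrary jammer
states; hence `R₁` is at most the minimax divergence.

The minimax theorem (`iInf_iSup_le_iSup_iInf_of_convexlike`) is proved for functions that may take
the value `+∞`: finitely many inputs are reduced to one by separation of convex sets in `ℝ^m`, and
the separating weights are perturbed to be strictly positive, since a weight zero would hide the
value `+∞`.
-/

namespace QuantumJammer

/-! ### Kraus maps and jammed outputs -/

section Kraus

variable {a : Type*} {b : Type*} {r : Type*} {s : Type*} {J : Type*}

/-- The map `X ↦ ∑ j, K j * X * (K j)ᴴ` with Kraus operators `K j`. -/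
def krausMap [Fintype J] [Fintype a] (K : J → Matrix b a ℂ) :
    Matrix a a ℂ →ₗ[ℂ] Matrix b b ℂ where
  toFun X := ∑ j, K j * X * (K j).conjTranspose
  map_add' X Y := by simp [Matrix.mul_add, Matrix.add_mul, Finset.sum_add_distrib]
  map_smul' c X := by simp [Finset.smul_sum]

theorem krausMap_apply_apply [Fintype J] [Fintype a] (K : J → Matrix b a ℂ) (X : Matrix a a ℂ)
    (i j : b) : krausMap K X i j = ∑ l, ∑ p, ∑ q, X p q * (K l i p * star (K l j q)) := by
  simp only [krausMap, LinearMap.coe_mk, AddHom.coe_mk, Matrix.sum_apply, Matrix.mul_apply,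
    Matrix.conjTranspose_apply, Finset.sum_mul]
  refine Finset.sum_congr rfl fun l _ => ?_
  rw [Finset.sum_comm]
  exact Finset.sum_congr rfl fun p _ => Finset.sum_congr rfl fun q _ => by ring

theorem posSemidef_krausMap [Fintype J] [Fintype a] [Fintype b] (K : J → Matrix b a ℂ)
    {X : Matrix a a ℂ} (hX : X.PosSemidef) : (krausMap K X).PosSemidef :=
  Matrix.posSemidef_sum _ fun j _ => hX.mul_mul_conjTranspose_same (K j)

theorem tensorId_krausMap [Fintype J] [Fintype a] [Fintype r] [DecidableEq r]
    (K : J → Matrix b a ℂ) (X : Matrix (a × r) (a × r) ℂ) :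
    tensorId (krausMap K) r X = krausMap (fun j => K j ⊗ₖ (1 : Matrix r r ℂ)) X := by
  ext ⟨i, k⟩ ⟨j, l⟩
  simp only [tensorId, LinearMap.coe_mk, AddHom.coe_mk, Matrix.of_apply, krausMap_apply_apply,
    Fintype.sum_prod_type, Matrix.kroneckerMap_apply, Matrix.one_apply]
  simp [apply_ite (starRingEnd ℂ)]

theorem posSemidef_tensorId_krausMap [Fintype J] [Fintype a] [Fintype b] [Fintype r]
    (K : J → Matrix b a ℂ) {X : Matrix (a × r) (a × r) ℂ} (hX : X.PosSemidef) :
    (tensorId (krausMap K) r X).PosSemidef := by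
  classical
  rw [tensorId_krausMap]
  exact posSemidef_krausMap _ hX

theorem isCP_krausMap [Fintype J] [Fintype a] [Fintype b] (K : J → Matrix b a ℂ) :
    IsCP (krausMap K) :=
  fun _ _ hX => posSemidef_tensorId_krausMap K hX

theorem isCPTP_krausMap [Fintype J] [Fintype a] [Fintype b] [DecidableEq a]
    (K : J → Matrix b a ℂ) (hK : ∑ j, (K j).conjTranspose * K j = 1) : IsCPTP (krausMap K) := by
  refine ⟨isCP_krausMap K, fun X => ?_⟩
  change (∑ j, K j * X * (K j).conjTranspose).trace = X.trace
  rw [Matrix.trace_sum]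
  have : ∀ j, (K j * X * (K j).conjTranspose).trace = ((K j).conjTranspose * K j * X).trace := by
    intro j
    rw [Matrix.trace_mul_comm, ← Matrix.mul_assoc]
  simp_rw [this]
  rw [← Matrix.trace_sum, ← Finset.sum_mul, hK, one_mul]

theorem linearMap_apply_eq_sum_single [Fintype a] [DecidableEq a]
    (Φ : Matrix a a ℂ →ₗ[ℂ] Matrix b b ℂ) (X : Matrix a a ℂ) (i j : b) :
    Φ X i j = ∑ p, ∑ q, X p q * Φ (Matrix.single p q 1) i j := by
  conv_lhs => rw [Matrix.matrix_eq_sum_single X]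
  simp only [map_sum, Matrix.sum_apply]
  refine Finset.sum_congr rfl fun p _ => Finset.sum_congr rfl fun q _ => ?_
  have : Matrix.single p q (X p q) = X p q • Matrix.single p q (1 : ℂ) := by
    rw [Matrix.smul_single, smul_eq_mul, mul_one]
  rw [this, map_smul, Matrix.smul_apply, smul_eq_mul]

theorem linearMap_ext_single [Fintype a] [DecidableEq a]
    {Φ Ψ : Matrix a a ℂ →ₗ[ℂ] Matrix b b ℂ}
    (h : ∀ p q i j, Φ (Matrix.single p q 1) i j = Ψ (Matrix.single p q 1) i j) : Φ = Ψ := by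
  ext X i j
  simp_rw [linearMap_apply_eq_sum_single _ X, h]

theorem krausMap_single [Fintype J] [Fintype a] [DecidableEq a] (K : J → Matrix b a ℂ)
    (p q : a) (i j : b) :
    krausMap K (Matrix.single p q 1) i j = ∑ l, K l i p * star (K l j q) := by
  rw [krausMap_apply_apply]
  refine Finset.sum_congr rfl fun l _ => ?_
  rw [Finset.sum_eq_single p, Finset.sum_eq_single q]
  · simp
  · intro q' _ hq'
    simp [hq'.symm]
  · simp
  · intro p' _ hp'
    simp [hp'.symm]
  · simp

/-- Completely positive maps have a Kraus representation. The Kraus operators are read off a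
decomposition of the Choi matrix, the image of the unnormalised maximally entangled state `|ξ⟩⟨ξ|`
under `Φ ⊗ id`, into rank-one operators. -/
theorem IsCP.exists_krausMap {a : Type u} {b : Type v} [Fintype a] [Fintype b]
    {Φ : Matrix a a ℂ →ₗ[ℂ] Matrix b b ℂ} (hΦ : IsCP Φ) :
    ∃ (m : ℕ) (K : Fin m → Matrix b a ℂ), Φ = krausMap K := by
  classical
  let f := Fintype.equivFin a
  let ξ : a × Fin (Fintype.card a) → ℂ := fun p => if f p.1 = p.2 then 1 else 0
  have hξ : (ketbra ξ).PosSemidef := Matrix.posSemidef_vecMulVec_self_star ξ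
  obtain ⟨m, v, hv⟩ := Matrix.posSemidef_iff_eq_sum_vecMulVec.1 (hΦ _ _ hξ)
  refine ⟨m, fun l => Matrix.of fun i p => v l (i, f p), linearMap_ext_single fun p q i j => ?_⟩
  rw [krausMap_single]
  have h1 : Matrix.single p q (1 : ℂ) = Matrix.of fun p' q' => ketbra ξ (p', f p) (q', f q) := by
    ext p' q'
    simp only [ketbra, Matrix.vecMulVec_apply, Matrix.of_apply, Matrix.single_apply, ξ,
      Pi.star_apply, f.injective.eq_iff, eq_comm (a := p), eq_comm (a := q)]
    by_cases h : p' = p <;> by_cases h' : q' = q <;> simp [h, h']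
  rw [h1]
  refine (congrFun (congrFun hv (i, f p)) (j, f q)).trans ?_
  simp [Matrix.sum_apply, Matrix.vecMulVec_apply]

/-- Positivity under an ancilla indexed by an arbitrary finite type rather than by `Fin k`. -/
theorem IsCP.posSemidef_tensorId {a : Type u} {b : Type v} [Fintype a] [Fintype b] [Fintype r]
    {Φ : Matrix a a ℂ →ₗ[ℂ] Matrix b b ℂ} (hΦ : IsCP Φ)
    {X : Matrix (a × r) (a × r) ℂ} (hX : X.PosSemidef) : (tensorId Φ r X).PosSemidef := by
  obtain ⟨m, K, rfl⟩ := hΦ.exists_krausMap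
  exact posSemidef_tensorId_krausMap K hX

end Kraus

section Jammed

variable {a e b : Type u} {r s : Type w}

theorem jammedOutput_apply (N : Matrix (a × e) (a × e) ℂ →ₗ[ℂ] Matrix b b ℂ)
    (ρ : Matrix (a × r) (a × r) ℂ) (σ : Matrix e e ℂ) (i j : b × r) :
    jammedOutput N ρ σ i j =
      N (Matrix.of fun p q => ρ (p.1, i.2) (q.1, j.2) * σ p.2 q.2) i.1 j.1 := rfl

theorem posSemidef_jammedOutput [Fintype a] [Fintype e] [Fintype b] [Fintype r]
    {N : Matrix (a × e) (a × e) ℂ →ₗ[ℂ] Matrix b b ℂ} (hN : IsCP N)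
    {ρ : Matrix (a × r) (a × r) ℂ} {σ : Matrix e e ℂ} (hρ : ρ.PosSemidef) (hσ : σ.PosSemidef) :
    (jammedOutput N ρ σ).PosSemidef :=
  hN.posSemidef_tensorId ((hρ.kronecker hσ).submatrix _)

theorem isDensity_jammedOutput [Fintype a] [Fintype e] [Fintype b] [Fintype r]
    {N : Matrix (a × e) (a × e) ℂ →ₗ[ℂ] Matrix b b ℂ} (hN : IsCPTP N)
    {ρ : Matrix (a × r) (a × r) ℂ} {σ : Matrix e e ℂ} (hρ : IsDensity ρ) (hσ : IsDensity σ) :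
    IsDensity (jammedOutput N ρ σ) := by
  refine ⟨posSemidef_jammedOutput hN.1 hρ.1 hσ.1, ?_⟩
  have h : (jammedOutput N ρ σ).trace = ρ.trace * σ.trace := by
    simp only [Matrix.trace, Matrix.diag, Fintype.sum_prod_type_right, jammedOutput_apply]
    have : ∀ k : r, ∑ i, N (Matrix.of fun p q => ρ (p.1, k) (q.1, k) * σ p.2 q.2) i i =
        ∑ p : a, ∑ q : e, ρ (p, k) (p, k) * σ q q := by
      intro k
      have := hN.2 (Matrix.of fun p q => ρ (p.1, k) (q.1, k) * σ p.2 q.2)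
      simpa only [Matrix.trace, Matrix.diag, Fintype.sum_prod_type, Matrix.of_apply] using this
    simp_rw [this, Finset.sum_mul, Finset.mul_sum]
  rw [h, hρ.2, hσ.2, one_mul]

theorem star_ite_zero (P : Prop) [Decidable P] (z : ℂ) :
    star (if P then z else 0) = if P then star z else 0 := by
  split_ifs <;> simp

/-- A map on the reference commutes with the action of `N`. -/
theorem jammedOutput_krausMap [Fintype b] [Fintype a] [Fintype s] {J : Type*} [Fintype J]
    [DecidableEq a] [DecidableEq b] (N : Matrix (a × e) (a × e) ℂ →ₗ[ℂ] Matrix b b ℂ)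
    (K : J → Matrix r s ℂ) (ρ : Matrix (a × s) (a × s) ℂ) (σ : Matrix e e ℂ) :
    jammedOutput N (krausMap (fun j => (1 : Matrix a a ℂ) ⊗ₖ K j) ρ) σ =
      krausMap (fun j => (1 : Matrix b b ℂ) ⊗ₖ K j) (jammedOutput N ρ σ) := by
  ext ⟨i, k⟩ ⟨j, l⟩
  rw [jammedOutput_apply, krausMap_apply_apply]
  have h : (Matrix.of fun p q : a × e => krausMap (fun j => (1 : Matrix a a ℂ) ⊗ₖ K j) ρ
      (p.1, k) (q.1, l) * σ p.2 q.2) = ∑ m : J, ∑ y : s, ∑ z : s, (K m k y * star (K m l z)) •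
        Matrix.of fun p q : a × e => ρ (p.1, y) (q.1, z) * σ p.2 q.2 := by
    ext p q
    simp only [Matrix.of_apply, krausMap_apply_apply, Fintype.sum_prod_type,
      Matrix.kroneckerMap_apply, Matrix.one_apply, Matrix.sum_apply, Matrix.smul_apply]
    simp only [ite_mul, one_mul, zero_mul, star_ite_zero, mul_ite, mul_zero, Finset.sum_ite_irrel,
      Finset.sum_const_zero, Finset.sum_ite_eq, Finset.mem_univ, if_true, Finset.sum_mul,
      smul_eq_mul]
    refine Finset.sum_congr rfl fun m _ => Finset.sum_congr rfl fun y _ =>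
      Finset.sum_congr rfl fun z _ => by ring
  rw [h]
  simp only [map_sum, map_smul, Matrix.sum_apply, Matrix.smul_apply, Fintype.sum_prod_type,
      Matrix.kroneckerMap_apply, Matrix.one_apply, jammedOutput_apply]
  simp only [ite_mul, one_mul, zero_mul, star_ite_zero, mul_ite, mul_zero, Finset.sum_ite_irrel,
      Finset.sum_const_zero, Finset.sum_ite_eq, Finset.mem_univ, if_true, smul_eq_mul]
  refine Finset.sum_congr rfl fun m _ => Finset.sum_congr rfl fun y _ =>
      Finset.sum_congr rfl fun z _ => by ring

theorem jammedOutput_sum {ι : Type*} (t : Finset ι)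
    (N : Matrix (a × e) (a × e) ℂ →ₗ[ℂ] Matrix b b ℂ) (ρ : Matrix (a × r) (a × r) ℂ)
    (p : ι → ℂ) (σ : ι → Matrix e e ℂ) :
    jammedOutput N ρ (∑ x ∈ t, p x • σ x) = ∑ x ∈ t, p x • jammedOutput N ρ (σ x) := by
  ext i j
  rw [jammedOutput_apply]
  have h : (Matrix.of fun p' q : a × e => ρ (p'.1, i.2) (q.1, j.2) *
      (∑ x ∈ t, p x • σ x) p'.2 q.2) = ∑ x ∈ t, p x •
        Matrix.of fun p' q : a × e => ρ (p'.1, i.2) (q.1, j.2) * σ x p'.2 q.2 := by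
    ext p' q
    simp only [Matrix.of_apply, Matrix.sum_apply, Matrix.smul_apply, smul_eq_mul, Finset.mul_sum]
    exact Finset.sum_congr rfl fun x _ => by ring
  rw [h]
  simp only [map_sum, map_smul, Matrix.sum_apply, Matrix.smul_apply, jammedOutput_apply]

theorem continuous_jammedOutput [Fintype a] [Fintype e]
    (N : Matrix (a × e) (a × e) ℂ →ₗ[ℂ] Matrix b b ℂ) (ρ : Matrix (a × r) (a × r) ℂ) :
    Continuous fun σ => jammedOutput N ρ σ := by
  classical
  refine continuous_matrix fun i j => ?_
  have h : ∀ σ, jammedOutput N ρ σ i j = ∑ p, ∑ q, ρ (p.1, i.2) (q.1, j.2) * σ p.2 q.2 *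
      N (Matrix.single p q 1) i.1 j.1 := fun σ => linearMap_apply_eq_sum_single N _ _ _
  simp_rw [h]
  fun_prop

end Jammed

/-! ### Tensor powers -/

section TensorPower

variable {a e b : Type u} {r : Type w} [Fintype a] [Fintype e] [DecidableEq a] [DecidableEq e]
  {n : ℕ}

theorem tensorPower_apply (N : Matrix (a × e) (a × e) ℂ →ₗ[ℂ] Matrix b b ℂ)
    (X : Matrix ((Fin n → a) × (Fin n → e)) ((Fin n → a) × (Fin n → e)) ℂ) (i j : Fin n → b) :
    tensorPower n N X i j = ∑ p, ∑ q, X p q *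
      ∏ m, N (Matrix.single (p.1 m, p.2 m) (q.1 m, q.2 m) 1) (i m) (j m) := rfl

theorem tensorPower_single (N : Matrix (a × e) (a × e) ℂ →ₗ[ℂ] Matrix b b ℂ)
    (p q : (Fin n → a) × (Fin n → e)) (i j : Fin n → b) :
    tensorPower n N (Matrix.single p q 1) i j =
      ∏ m, N (Matrix.single (p.1 m, p.2 m) (q.1 m, q.2 m) 1) (i m) (j m) := by
  rw [tensorPower_apply, Finset.sum_eq_single p, Finset.sum_eq_single q]
  · simp
  · intro q' _ hq'
    simp [hq'.symm]
  · simp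
  · intro p' _ hp'
    simp [hp'.symm]
  · simp

/-- The Kraus operators of a tensor power are the tensor products of the Kraus operators. This is
why tensor powers of completely positive maps are completely positive. -/
theorem tensorPower_krausMap {J : Type*} [Fintype J] (K : J → Matrix b (a × e) ℂ) :
    tensorPower n (krausMap K) = krausMap fun l : Fin n → J =>
      Matrix.of fun i p => ∏ m, K (l m) (i m) (p.1 m, p.2 m) := by
  refine linearMap_ext_single fun p q i j => ?_
  rw [tensorPower_single, krausMap_single]
  simp_rw [krausMap_single, Finset.prod_univ_sum, Fintype.piFinset_univ, Matrix.of_apply,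
    star_prod, Finset.prod_mul_distrib]

theorem isCP_tensorPower [Fintype b] {N : Matrix (a × e) (a × e) ℂ →ₗ[ℂ] Matrix b b ℂ}
    (hN : IsCP N) : IsCP (tensorPower n N) := by
  obtain ⟨m, K, rfl⟩ := hN.exists_krausMap
  rw [tensorPower_krausMap]
  exact isCP_krausMap _

theorem isCPTP_tensorPower [Fintype b] {N : Matrix (a × e) (a × e) ℂ →ₗ[ℂ] Matrix b b ℂ}
    (hN : IsCPTP N) : IsCPTP (tensorPower n N) := by
  refine ⟨isCP_tensorPower hN.1, fun X => ?_⟩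
  simp only [Matrix.trace, Matrix.diag, tensorPower_apply]
  rw [Finset.sum_comm]
  refine Finset.sum_congr rfl fun p _ => ?_
  rw [Finset.sum_comm]
  have h : ∀ q : (Fin n → a) × (Fin n → e), ∑ i : Fin n → b, X p q *
      ∏ m, N (Matrix.single (p.1 m, p.2 m) (q.1 m, q.2 m) 1) (i m) (i m) =
      if p = q then X p q else 0 := by
    intro q
    rw [← Finset.mul_sum, ← Fintype.piFinset_univ, ← Finset.prod_univ_sum (fun _ => Finset.univ)
      fun m i => N (Matrix.single (p.1 m, p.2 m) (q.1 m, q.2 m) 1) i i]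
    have : ∀ m, ∑ i, N (Matrix.single (p.1 m, p.2 m) (q.1 m, q.2 m) 1) i i =
        if p.1 m = q.1 m ∧ p.2 m = q.2 m then 1 else 0 := by
      intro m
      refine (hN.2 _).trans ?_
      split_ifs with hpq
      · rw [hpq.1, hpq.2, Matrix.trace_single_eq_same]
      · exact Matrix.trace_single_eq_of_ne _ _ _ (by simpa [Prod.ext_iff] using hpq)
    simp_rw [this]
    split_ifs with hpq
    · simp [hpq]
    · have : ∃ m, ¬ (p.1 m = q.1 m ∧ p.2 m = q.2 m) := by
        by_contra! hc
        exact hpq (Prod.ext (funext fun m => (hc m).1) (funext fun m => (hc m).2))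
      obtain ⟨m, hm⟩ := this
      rw [Finset.prod_eq_zero (Finset.mem_univ m) (if_neg hm), mul_zero]
  simp_rw [h]
  simp

/-- Permutation covariance: permuting the `n` copies of `A` and of `E` in the input permutes the
`n` copies of `B` in the output. -/
theorem jammedOutput_tensorPower_perm (N : Matrix (a × e) (a × e) ℂ →ₗ[ℂ] Matrix b b ℂ)
    (π : Equiv.Perm (Fin n)) (ρ : Matrix ((Fin n → a) × r) ((Fin n → a) × r) ℂ)
    (σ : Matrix (Fin n → e) (Fin n → e) ℂ) :
    jammedOutput (tensorPower n N)
      (ρ.submatrix (fun i => (i.1 ∘ π, i.2)) (fun i => (i.1 ∘ π, i.2)))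
      (σ.submatrix (fun s => s ∘ π) (fun s => s ∘ π)) =
    (jammedOutput (tensorPower n N) ρ σ).submatrix
      (fun i => (i.1 ∘ π, i.2)) (fun i => (i.1 ∘ π, i.2)) := by
  ext ⟨i, k⟩ ⟨j, l⟩
  let t : (Fin n → a) × (Fin n → e) ≃ (Fin n → a) × (Fin n → e) :=
    Equiv.prodCongr (Equiv.arrowCongr π.symm (Equiv.refl _))
      (Equiv.arrowCongr π.symm (Equiv.refl _))
  simp only [Matrix.submatrix_apply, jammedOutput_apply, tensorPower_apply, Matrix.of_apply]
  refine Fintype.sum_equiv t _ _ fun p => Fintype.sum_equiv t _ _ fun q => ?_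
  refine congrArg₂ (· * ·) rfl ?_
  exact (Equiv.prod_comp π fun m =>
    N (Matrix.single (p.1 m, p.2 m) (q.1 m, q.2 m) 1) (i m) (j m)).symm

end TensorPower

/-! ### A Fan-type minimax theorem for extended-real functions -/

/-- If every point of a nonempty convex set `V` of `ℝ^m` has a coordinate that is at least `c`, then
some fixed convex combination of the coordinates is at least `c` on all of `V`: separate `V` from
the open orthant of the points with all coordinates below `c`. -/
theorem exists_weights_le_sum {m : ℕ} {V : Set (Fin m → ℝ)} (hV : Convex ℝ V)
    (hne : V.Nonempty) {c : ℝ} (h : ∀ v ∈ V, ∃ i, c ≤ v i) :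
    ∃ p : Fin m → ℝ, (∀ i, 0 ≤ p i) ∧ ∑ i, p i = 1 ∧ ∀ v ∈ V, c ≤ ∑ i, p i * v i := by
  set W : Set (Fin m → ℝ) := Set.univ.pi fun _ => Set.Iio c with hW
  have hWmem : ∀ w : Fin m → ℝ, w ∈ W ↔ ∀ i, w i < c := by simp [hW]
  have hdisj : Disjoint W V := by
    rw [Set.disjoint_left]
    intro w hw hv
    obtain ⟨i, hi⟩ := h w hv
    exact absurd ((hWmem w).1 hw i) (not_lt.2 hi)
  obtain ⟨g, r, hgW, hgV⟩ := geometric_hahn_banach_open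
    (convex_pi fun _ _ => convex_Iio c) (isOpen_set_pi Set.finite_univ fun _ _ => isOpen_Iio)
    hV hdisj
  set l : Fin m → ℝ := fun i => g (Pi.single i 1) with hl
  have hg : ∀ v, g v = ∑ i, l i * v i := by
    intro v
    conv_lhs => rw [pi_eq_sum_univ' v]
    simp only [map_sum, map_smul, smul_eq_mul, hl]
    refine Finset.sum_congr rfl fun i _ => ?_
    rw [mul_comm]
  -- `W` is unbounded below in every coordinate, so no coefficient is negative
  have hl0 : ∀ i, 0 ≤ l i := by
    intro i
    by_contra! hi
    set A := g (fun _ => c - 1)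
    set t := |r - A| / (-l i) with ht
    have ht0 : 0 ≤ t := div_nonneg (abs_nonneg _) (by linarith)
    have hmem : (fun _ => c - 1) - t • (Pi.single i 1 : Fin m → ℝ) ∈ W := by
      rw [hWmem]
      intro j
      have : 0 ≤ t * (Pi.single i 1 : Fin m → ℝ) j :=
        mul_nonneg ht0 (by by_cases hj : j = i <;> simp [hj])
      simp only [Pi.sub_apply, Pi.smul_apply, smul_eq_mul]
      linarith
    have h1 := hgW _ hmem
    rw [map_sub, map_smul, smul_eq_mul] at h1
    have h2 : t * l i = -|r - A| := by
      rw [ht]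
      have : l i ≠ 0 := hi.ne
      field_simp
    have h3 : t * g (Pi.single i 1) = -|r - A| := h2
    rw [h3] at h1
    have := le_abs_self (r - A)
    change A - -|r - A| < r at h1
    linarith
  have hcl : ∀ ε > 0, (c - ε) * ∑ i, l i < r := by
    intro ε hε
    have := hgW (fun _ => c - ε) ((hWmem _).2 fun _ => by linarith)
    rwa [hg, ← Finset.sum_mul, mul_comm] at this
  set S := ∑ i, l i with hS
  obtain ⟨v₀, hv₀⟩ := hne
  have hS0 : 0 < S := by
    rcases (Finset.sum_nonneg fun i _ => hl0 i : 0 ≤ S).eq_or_lt with h0 | h0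
    · have h1 := hcl 1 one_pos
      have h2 := hgV v₀ hv₀
      have h3 : ∀ i, l i = 0 := fun i =>
        (Finset.sum_eq_zero_iff_of_nonneg fun i _ => hl0 i).1 h0.symm i (Finset.mem_univ i)
      rw [hg] at h2
      simp only [h3, zero_mul, Finset.sum_const_zero] at h2
      rw [hS.trans h0.symm, mul_zero] at h1
      linarith
    · exact h0
  have hcr : c * S ≤ r := by
    refine le_of_forall_pos_le_add fun ε hε => ?_
    have := hcl (ε / S) (by positivity)
    rw [sub_mul, div_mul_cancel₀ _ hS0.ne'] at this
    linarith
  refine ⟨fun i => l i / S, fun i => div_nonneg (hl0 i) hS0.le, ?_, fun v hv => ?_⟩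
  · rw [← Finset.sum_div, div_self hS0.ne']
  · have h1 := hgV v hv
    rw [hg] at h1
    have : ∑ i, l i / S * v i = (∑ i, l i * v i) / S := by
      rw [Finset.sum_div]
      exact Finset.sum_congr rfl fun i _ => by ring
    rw [this, le_div_iff₀ hS0]
    linarith

theorem ereal_coe_sum {ι : Type*} (s : Finset ι) (g : ι → ℝ) :
    ((∑ i ∈ s, g i : ℝ) : EReal) = ∑ i ∈ s, (g i : EReal) :=
  map_sum (⟨⟨Real.toEReal, EReal.coe_zero⟩, EReal.coe_add⟩ : ℝ →+ EReal) g s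

theorem ereal_sum_eq_top_of_pos {ι : Type*} [Fintype ι] {p : ι → ℝ} {g : ι → EReal}
    (hp : ∀ i, 0 < p i) (hg : ∀ i, g i ≠ ⊥) {j : ι} (hj : g j = ⊤) :
    ∑ i, (p i : EReal) * g i = ⊤ := by
  classical
  have hne : ∀ s : Finset ι, ∑ i ∈ s, (p i : EReal) * g i ≠ ⊥ := by
    intro s
    induction s using Finset.induction_on with
    | empty => simp
    | insert a s ha ih =>
      rw [Finset.sum_insert ha, ne_eq, EReal.add_eq_bot_iff, not_or]
      refine ⟨?_, ih⟩
      rw [EReal.mul_eq_bot]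
      simp [hg a, (hp a).not_gt]
  rw [← Finset.add_sum_erase _ _ (Finset.mem_univ j), hj, EReal.coe_mul_top_of_pos (hp j)]
  exact EReal.top_add_of_ne_bot (hne _)

/-- A minimax inequality of Fan's type for functions with values in `ℝ ∪ {+∞}`. On the compact side
`f` is lower semicontinuous and convexlike (a convex combination of two values is dominated by the
value at some point, uniformly in `y`); on the other side it is concavelike, with no topology. -/
theorem iInf_iSup_le_iSup_iInf_of_convexlike {X Y : Type*} [TopologicalSpace X] [CompactSpace X]
    [Nonempty Y] (f : X → Y → EReal) (hbot : ∀ x y, f x y ≠ ⊥)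
    (hlsc : ∀ y, LowerSemicontinuous fun x => f x y)
    (hconv : ∀ (x x' : X) (s t : ℝ), 0 ≤ s → 0 ≤ t → s + t = 1 →
      ∃ z, ∀ y, f z y ≤ s * f x y + t * f x' y)
    (hconc : ∀ (m : ℕ) (p : Fin m → ℝ) (y : Fin m → Y), (∀ i, 0 ≤ p i) → ∑ i, p i = 1 →
      ∃ z, ∀ x, ∑ i, (p i : EReal) * f x (y i) ≤ f x z) :
    ⨅ x, ⨆ y, f x y ≤ ⨆ y, ⨅ x, f x y := by
  rcases isEmpty_or_nonempty X with hX | hX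
  · exact le_iSup_of_le (Classical.arbitrary Y) (by simp [iInf_of_isEmpty])
  refine le_of_forall_lt_imp_le_of_dense fun c' hc' => ?_
  obtain ⟨c, hc'c, hc⟩ := EReal.exists_between_coe_real hc'
  refine le_of_forall_lt_imp_le_of_dense fun d hd => ?_
  have hdc : d < (c : EReal) := hd.trans hc'c
  -- finitely many `y i` suffice to push the maximum above `c` at every point of `X`
  have hcov : (Set.univ : Set X) ⊆ ⋃ y, {x | (c : EReal) < f x y} := by
    intro x _
    have : (c : EReal) < ⨆ y, f x y := hc.trans_le (iInf_le _ x)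
    obtain ⟨y, hy⟩ := lt_iSup_iff.1 this
    exact Set.mem_iUnion.2 ⟨y, hy⟩
  obtain ⟨F, hF⟩ := isCompact_univ.elim_finite_subcover _
    (fun y => (hlsc y).isOpen_preimage (c : EReal)) hcov
  set m := F.card
  set y : Fin m → Y := fun i => (F.equivFin.symm i : Y) with hy
  have hmax : ∀ x, ∃ i, (c : EReal) < f x (y i) := by
    intro x
    obtain ⟨z, hz, hxz⟩ := Set.mem_iUnion₂.1 (hF (Set.mem_univ x))
    exact ⟨F.equivFin ⟨z, hz⟩, by simpa [hy] using hxz⟩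
  have hm : 0 < m := by
    obtain ⟨i, _⟩ := hmax hX.some
    exact i.pos
  -- a common real lower bound of the `f · (y i)`
  have hlow : ∃ β : ℝ, ∀ x i, (β : EReal) ≤ f x (y i) := by
    have : ∀ i, ∃ β : ℝ, ∀ x, (β : EReal) ≤ f x (y i) := by
      intro i
      obtain ⟨x₀, -, hx₀⟩ := LowerSemicontinuousOn.exists_isMinOn Set.univ_nonempty
        isCompact_univ ((hlsc (y i)).lowerSemicontinuousOn Set.univ)
      obtain ⟨β, -, hβ⟩ := EReal.exists_between_coe_real (bot_lt_iff_ne_bot.2 (hbot x₀ (y i)))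
      exact ⟨β, fun x => hβ.le.trans (hx₀ (Set.mem_univ x))⟩
    choose β hβ using this
    have : Nonempty (Fin m) := ⟨⟨0, hm⟩⟩
    refine ⟨Finset.univ.inf' Finset.univ_nonempty β, fun x i => le_trans ?_ (hβ i x)⟩
    exact_mod_cast Finset.inf'_le _ (Finset.mem_univ i)
  obtain ⟨β, hβ⟩ := hlow
  set V : Set (Fin m → ℝ) := {v | ∃ x, ∀ i, f x (y i) ≤ v i} with hV
  have hVconv : Convex ℝ V := by
    rintro v ⟨x, hx⟩ v' ⟨x', hx'⟩ s t hs ht hst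
    obtain ⟨z, hz⟩ := hconv x x' s t hs ht hst
    refine ⟨z, fun i => (hz (y i)).trans ?_⟩
    simp only [Pi.add_apply, Pi.smul_apply, smul_eq_mul, EReal.coe_add, EReal.coe_mul]
    exact add_le_add (mul_le_mul_of_nonneg_left (hx i) (by exact_mod_cast hs))
      (mul_le_mul_of_nonneg_left (hx' i) (by exact_mod_cast ht))
  have hVc : ∀ v ∈ V, ∃ i, c ≤ v i := by
    rintro v ⟨x, hx⟩
    obtain ⟨i, hi⟩ := hmax x
    exact ⟨i, by exact_mod_cast (hi.trans_le (hx i)).le⟩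
  have hm' : (0 : ℝ) < m := by exact_mod_cast hm
  have hunif : ∑ _i : Fin m, (1 / m : ℝ) = 1 := by
    simp [hm'.ne']
  have hw : ∃ p : Fin m → ℝ, (∀ i, 0 ≤ p i) ∧ ∑ i, p i = 1 ∧ ∀ v ∈ V, c ≤ ∑ i, p i * v i := by
    rcases V.eq_empty_or_nonempty with h0 | h0
    · exact ⟨fun _ => 1 / m, fun _ => by positivity, hunif, by simp [h0]⟩
    · exact exists_weights_le_sum hVconv h0 hVc
  obtain ⟨p, hp0, hp1, hpV⟩ := hw
  obtain ⟨d', hdd', hd'c⟩ := EReal.exists_between_coe_real hdc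
  have hd'c' : d' < c := by exact_mod_cast hd'c
  obtain ⟨ε, hε0, hε1, hε⟩ : ∃ ε : ℝ, 0 < ε ∧ ε < 1 ∧ d' ≤ (1 - ε) * c + ε * β := by
    refine ⟨min (1 / 2) ((c - d') / (|c - β| + 1)), ?_, ?_, ?_⟩
    · have : 0 < c - d' := by linarith
      positivity
    · exact (min_le_left _ _).trans_lt (by norm_num)
    · set ε := min (1 / 2) ((c - d') / (|c - β| + 1))
      have h1 : ε * (|c - β| + 1) ≤ c - d' := by
        rw [← le_div_iff₀ (by positivity)]
        exact min_le_right _ _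
      have h0 : 0 ≤ ε := le_min (by norm_num) (div_nonneg (by linarith) (by positivity))
      have h2 : ε * (c - β) ≤ ε * (|c - β| + 1) :=
        mul_le_mul_of_nonneg_left (by linarith [le_abs_self (c - β)]) h0
      nlinarith
  -- mix with the uniform weights: a weight zero would hide an infinite value `f x (y i)`
  set q : Fin m → ℝ := fun i => (1 - ε) * p i + ε * (1 / m) with hq
  have hq0 : ∀ i, 0 < q i := fun i =>
    add_pos_of_nonneg_of_pos (mul_nonneg (by linarith) (hp0 i)) (by positivity)
  have hq1 : ∑ i, q i = 1 := by
    simp only [hq]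
    rw [Finset.sum_add_distrib, ← Finset.mul_sum, ← Finset.mul_sum, hp1, hunif]
    ring
  obtain ⟨z, hz⟩ := hconc m q y (fun i => (hq0 i).le) hq1
  refine hdd'.le.trans (le_iSup_of_le z (le_iInf fun x => le_trans ?_ (hz x)))
  by_cases htop : ∃ j, f x (y j) = ⊤
  · obtain ⟨j, hj⟩ := htop
    rw [ereal_sum_eq_top_of_pos hq0 (fun i => hbot x (y i)) hj]
    exact le_top
  · push Not at htop
    have hv : ∀ i, ((f x (y i)).toReal : EReal) = f x (y i) := fun i =>
      EReal.coe_toReal (htop i) (hbot x (y i))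
    set v : Fin m → ℝ := fun i => (f x (y i)).toReal with hvdef
    have hvV : v ∈ V := ⟨x, fun i => (hv i).ge⟩
    have h1 := hpV v hvV
    have h2 : β ≤ ∑ i, (1 / m : ℝ) * v i := by
      calc β = ∑ _i : Fin m, (1 / m : ℝ) * β := by rw [← Finset.sum_mul, hunif, one_mul]
        _ ≤ _ := Finset.sum_le_sum fun i _ => by
          refine mul_le_mul_of_nonneg_left ?_ (by positivity)
          have := hβ x i
          rw [← hv i] at this
          exact_mod_cast this
    have h3 : d' ≤ ∑ i, q i * v i := by
      have : ∑ i, q i * v i = (1 - ε) * ∑ i, p i * v i + ε * ∑ i, (1 / m : ℝ) * v i := by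
        rw [Finset.mul_sum, Finset.mul_sum, ← Finset.sum_add_distrib]
        exact Finset.sum_congr rfl fun i _ => by simp only [hq]; ring
      rw [this]
      refine hε.trans (add_le_add (mul_le_mul_of_nonneg_left h1 (by linarith))
        (mul_le_mul_of_nonneg_left h2 hε0.le))
    have h4 : ∑ i, (q i : EReal) * f x (y i) = ((∑ i, q i * v i : ℝ) : EReal) := by
      rw [ereal_coe_sum]
      exact Finset.sum_congr rfl fun i _ => by rw [EReal.coe_mul, hv i]
    rw [h4]
    exact_mod_cast h3

/-! ### Purifications -/

/-- The Moore–Penrose inverse of a Hermitian matrix, with two of its properties. -/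
theorem exists_hermitian_pseudoinverse {a : Type*} [Fintype a] {G : Matrix a a ℂ}
    (hG : G.IsHermitian) : ∃ H : Matrix a a ℂ, H.IsHermitian ∧ H * G * H = H ∧ G * H * G = G := by
  classical
  obtain ⟨φ, d, hφ⟩ : ∃ (φ : Matrix a a ℂ ≃⋆ₐ[ℂ] Matrix a a ℂ) (d : a → ℝ),
      G = φ (Matrix.diagonal fun i => (d i : ℂ)) := ⟨_, _, hG.spectral_theorem⟩
  -- where `d i = 0`, the convention `0⁻¹ = 0` is the right choice
  have key : ∀ x : ℝ, x⁻¹ * x * x⁻¹ = x⁻¹ ∧ x * x⁻¹ * x = x := by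
    intro x
    by_cases hx : x = 0
    · simp [hx]
    · constructor <;> field_simp
  subst hφ
  refine ⟨φ (Matrix.diagonal fun i => ((d i)⁻¹ : ℝ)), ?_, ?_, ?_⟩
  · rw [Matrix.IsHermitian, ← Matrix.star_eq_conjTranspose, ← map_star,
      Matrix.star_eq_conjTranspose, Matrix.diagonal_conjTranspose]
    congr 2
    ext i
    simp
  · rw [← map_mul, ← map_mul, Matrix.diagonal_mul_diagonal, Matrix.diagonal_mul_diagonal]
    congr 2
    ext i
    exact_mod_cast (key (d i)).1
  · rw [← map_mul, ← map_mul, Matrix.diagonal_mul_diagonal, Matrix.diagonal_mul_diagonal]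
    congr 2
    ext i
    exact_mod_cast (key (d i)).2

theorem mul_eq_self_of_mul_mul_conjTranspose_eq {a d : Type*} [Fintype a] [Fintype d]
    {E : Matrix a a ℂ} {Z : Matrix a d ℂ}
    (h : E * (Z * Z.conjTranspose) = Z * Z.conjTranspose) : E * Z = Z := by
  have h0 : (Z - E * Z) * (Z - E * Z).conjTranspose = 0 := by
    rw [Matrix.conjTranspose_sub, Matrix.conjTranspose_mul, Matrix.mul_sub, Matrix.sub_mul,
      Matrix.mul_assoc, h, sub_self, ← Matrix.mul_assoc, Matrix.sub_mul, Matrix.mul_assoc E, h,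
      sub_self, Matrix.zero_mul, sub_zero]
  exact (sub_eq_zero.1 (Matrix.self_mul_conjTranspose_eq_zero.1 h0)).symm

/-- If `Φ Φᴴ = Ψ Ψᴴ`, then `Φ = Ψ L` where `L Lᴴ` is an orthogonal projection that `Ψ` absorbs.
With `H` the pseudoinverse of `Ψ Ψᴴ`, the factor is `L = Ψᴴ H Φ`. -/
theorem exists_partialIsometry_factor {a s c : Type*} [Fintype a] [Fintype s] [Fintype c]
    (Ψ : Matrix a s ℂ) (Φ : Matrix a c ℂ) (h : Φ * Φ.conjTranspose = Ψ * Ψ.conjTranspose) :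
    ∃ L : Matrix s c ℂ, Ψ * L = Φ ∧ Ψ * (L * L.conjTranspose) = Ψ ∧
      L * L.conjTranspose * (L * L.conjTranspose) = L * L.conjTranspose := by
  classical
  obtain ⟨H, hH, hHGH, hGHG⟩ := exists_hermitian_pseudoinverse 
    (Matrix.isHermitian_mul_conjTranspose_self Ψ)
  set G := Ψ * Ψ.conjTranspose with hG
  have hL : Ψ.conjTranspose * H * Φ * (Ψ.conjTranspose * H * Φ).conjTranspose =
      Ψ.conjTranspose * H * Ψ := by
    rw [Matrix.conjTranspose_mul, Matrix.conjTranspose_mul, Matrix.conjTranspose_conjTranspose,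
      hH.eq]
    calc Ψ.conjTranspose * H * Φ * (Φ.conjTranspose * (H * Ψ))
        = Ψ.conjTranspose * (H * (Φ * Φ.conjTranspose) * H) * Ψ := by simp only [Matrix.mul_assoc]
      _ = _ := by rw [h, hHGH]
  refine ⟨Ψ.conjTranspose * H * Φ, ?_, ?_, ?_⟩
  · rw [← Matrix.mul_assoc, ← Matrix.mul_assoc, ← hG]
    exact mul_eq_self_of_mul_mul_conjTranspose_eq (by rw [h, hGHG])
  · rw [hL, ← Matrix.mul_assoc, ← Matrix.mul_assoc, ← hG]
    exact mul_eq_self_of_mul_mul_conjTranspose_eq hGHG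
  · rw [hL]
    calc Ψ.conjTranspose * H * Ψ * (Ψ.conjTranspose * H * Ψ)
        = Ψ.conjTranspose * (H * (Ψ * Ψ.conjTranspose) * H) * Ψ := by
          simp only [Matrix.mul_assoc]
      _ = _ := by rw [← hG, hHGH]

/-- The reduced operator `ρ_A` of `ρ_{AR}`, the partial trace over `R`. -/
def marginal {a : Type*} {r : Type*} [Fintype r] (ρ : Matrix (a × r) (a × r) ℂ) : Matrix a a ℂ :=
  Matrix.of fun i j => ∑ k, ρ (i, k) (j, k)

/-- Every state `ρ_{AR}` arises from any purification `ψ` of its marginal `ρ_A` by a quantum channel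
acting on the purifying system alone. -/
theorem exists_krausMap_purification {a : Type u} {s : Type v} {r : Type w} [Fintype a]
    [Fintype s] [Fintype r] [DecidableEq a] [DecidableEq s] [Nonempty r] (ψ : a × s → ℂ)
    {ρ : Matrix (a × r) (a × r) ℂ} (hρ : ρ.PosSemidef) (hψ : IsPurification ψ (marginal ρ)) :
    ∃ (m : ℕ) (K : Fin m ⊕ s → Matrix r s ℂ), ∑ j, (K j).conjTranspose * K j = 1 ∧
      krausMap (fun j => (1 : Matrix a a ℂ) ⊗ₖ K j) (ketbra ψ) = ρ := by
  classical
  obtain ⟨m, v, hv⟩ := Matrix.posSemidef_iff_eq_sum_vecMulVec.1 hρ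
  set Ψ : Matrix a s ℂ := Matrix.of fun i k => ψ (i, k) with hΨ
  set Φ : Matrix a (Fin m × r) ℂ := Matrix.of fun i jk => v jk.1 (i, jk.2) with hΦ
  have h : Φ * Φ.conjTranspose = Ψ * Ψ.conjTranspose := by
    ext i j
    have h1 := hψ i j
    simp only [marginal, hv, ketbra, Matrix.sum_apply, Matrix.vecMulVec_apply, Pi.star_apply,
      Matrix.of_apply] at h1
    rw [Finset.sum_comm (s := Finset.univ (α := r))] at h1
    simp only [Matrix.mul_apply, Matrix.conjTranspose_apply, hΨ, hΦ, Matrix.of_apply,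
      Fintype.sum_prod_type, h1]
  obtain ⟨L, hL, hΨP, hPP⟩ := exists_partialIsometry_factor Ψ Φ h
  set P := L * L.conjTranspose with hP
  have hPh : P.conjTranspose = P := Matrix.isHermitian_mul_conjTranspose_self L
  have k₀ : r := Classical.arbitrary r
  let K₁ : Fin m → Matrix r s ℂ := fun j => Matrix.of fun k t => L t (j, k)
  -- `K₂` completes `K₁` to a trace-preserving family; it annihilates `ψ`
  let K₂ : s → Matrix r s ℂ := fun t => Matrix.of fun k t' => if k = k₀ then (1 - P) t' t else 0
  have hone : ∀ (K : Matrix r s ℂ) (i : a) (k : r),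
      (((1 : Matrix a a ℂ) ⊗ₖ K).mulVec ψ) (i, k) = ∑ t, Ψ i t * K k t := by
    intro K i k
    simp only [Matrix.mulVec, dotProduct, Fintype.sum_prod_type, Matrix.kroneckerMap_apply,
      Matrix.one_apply, ite_mul, one_mul, zero_mul, Finset.sum_ite_irrel, Finset.sum_const_zero,
      Finset.sum_ite_eq, Finset.mem_univ, if_true, hΨ, Matrix.of_apply]
    exact Finset.sum_congr rfl fun t _ => mul_comm _ _
  have h₁ : ∀ j, ((1 : Matrix a a ℂ) ⊗ₖ K₁ j).mulVec ψ = v j := by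
    intro j
    ext ⟨i, k⟩
    rw [hone]
    exact congrFun (congrFun hL i) (j, k)
  have h₂ : ∀ t, ((1 : Matrix a a ℂ) ⊗ₖ K₂ t).mulVec ψ = 0 := by
    intro t
    ext ⟨i, k⟩
    rw [hone]
    by_cases hk : k = k₀
    · have : (Ψ * (1 - P) : Matrix a s ℂ) i t = 0 := by
        rw [Matrix.mul_sub, Matrix.mul_one, hΨP, sub_self, Matrix.zero_apply]
      simpa [K₂, hk, Matrix.mul_apply] using this
    · simp [K₂, hk]
  refine ⟨m, Sum.elim K₁ K₂, ?_, ?_⟩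
  · rw [Fintype.sum_sum_type]
    simp only [Sum.elim_inl, Sum.elim_inr]
    have e₁ : ∑ j, (K₁ j).conjTranspose * K₁ j = P.transpose := by
      ext t t'
      simp only [Matrix.sum_apply, Matrix.mul_apply, Matrix.conjTranspose_apply, K₁,
        Matrix.of_apply, hP, Matrix.transpose_apply, Fintype.sum_prod_type]
      exact Finset.sum_congr rfl fun j _ => Finset.sum_congr rfl fun k _ => mul_comm _ _
    have e₂ : ∑ j, (K₂ j).conjTranspose * K₂ j = (1 - P).transpose := by
      have hQ : (1 - P) * (1 - P).conjTranspose = 1 - P := by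
        rw [Matrix.conjTranspose_sub, Matrix.conjTranspose_one, hPh, Matrix.sub_mul,
          Matrix.mul_sub, Matrix.mul_sub, hPP]
        simp
      ext t t'
      conv_rhs => rw [← hQ]
      simp only [Matrix.sum_apply, Matrix.mul_apply, Matrix.conjTranspose_apply, K₂,
        Matrix.of_apply, Matrix.transpose_apply]
      refine Finset.sum_congr rfl fun y _ => ?_
      rw [Finset.sum_eq_single k₀]
      · simp [mul_comm]
      · intro k _ hk
        simp [hk]
      · simp
    rw [e₁, e₂, ← Matrix.transpose_add, add_sub_cancel, Matrix.transpose_one]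
  · have hk : ∀ A : Matrix (a × r) (a × s) ℂ,
        A * ketbra ψ * A.conjTranspose = ketbra (A.mulVec ψ) := by
      intro A
      rw [ketbra, ketbra, Matrix.mul_vecMulVec, Matrix.vecMulVec_mul, Matrix.star_mulVec]
    change ∑ j, _ * ketbra ψ * Matrix.conjTranspose _ = ρ
    simp_rw [hk]
    rw [Fintype.sum_sum_type]
    simp only [Sum.elim_inl, Sum.elim_inr, h₁, h₂]
    rw [hv]
    simp [ketbra]

/-! ### Divergences -/

/-- Relabelling of the basis along `f`; for a bijection this is conjugation with a unitary. -/
def submatrixMap {a : Type u} {b : Type v} (f : b → a) : Matrix a a ℂ →ₗ[ℂ] Matrix b b ℂ where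
  toFun X := X.submatrix f f
  map_add' _ _ := rfl
  map_smul' _ _ := rfl

theorem isCPTP_submatrixMap {a : Type u} {b : Type v} [Fintype a] [Fintype b] (f : b ≃ a) :
    IsCPTP (submatrixMap f) :=
  ⟨fun _ _ hX => hX.submatrix (Prod.map f id), fun X => Equiv.sum_comp f fun i => X i i⟩

/-- The partial trace over the first tensor factor. -/
def partialTrace {a : Type u} (c : Type v) [Fintype c] :
    Matrix (c × a) (c × a) ℂ →ₗ[ℂ] Matrix a a ℂ where
  toFun X := ∑ x, X.submatrix (fun i => (x, i)) (fun i => (x, i))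
  map_add' X Y := by
    rw [← Finset.sum_add_distrib]; rfl
  map_smul' c X := by
    rw [Finset.smul_sum]; rfl

theorem isCPTP_partialTrace {a : Type u} (c : Type v) [Fintype a] [Fintype c] :
    IsCPTP (partialTrace (a := a) c) := by
  refine ⟨fun k X hX => ?_, fun X => ?_⟩
  · have : tensorId (partialTrace (a := a) c) (Fin k) X =
        ∑ x, X.submatrix (fun i => ((x, i.1), i.2)) (fun i => ((x, i.1), i.2)) := by
      ext i j
      simp [tensorId, partialTrace, Matrix.sum_apply]
    rw [this]
    exact Matrix.posSemidef_sum _ fun x _ => hX.submatrix _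
  · simp [partialTrace, Matrix.trace, Fintype.sum_prod_type, Matrix.sum_apply]
    exact Finset.sum_comm

theorem cqOperator_apply {a : Type u} {k : ℕ} (p : Fin k → ℝ) (τ : Fin k → Matrix a a ℂ)
    (i j : Fin k × a) :
    cqOperator p τ i j = if i.1 = j.1 then (p i.1 : ℂ) * τ i.1 i.2 j.2 else 0 := by
  simp only [cqOperator, Matrix.sum_apply, Matrix.smul_apply, Matrix.kroneckerMap_apply,
    Matrix.single_apply, smul_eq_mul]
  rw [Finset.sum_eq_single i.1]
  · by_cases h : i.1 = j.1 <;> simp [h]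
  · intro x _ hx
    simp [hx]
  · simp

theorem partialTrace_cqOperator {a : Type u} {k : ℕ} (p : Fin k → ℝ)
    (τ : Fin k → Matrix a a ℂ) :
    partialTrace (Fin k) (cqOperator p τ) = ∑ x, (p x : ℂ) • τ x := by
  ext i j
  simp [partialTrace, Matrix.sum_apply, cqOperator_apply]

theorem posSemidef_cqOperator {a : Type u} [Fintype a] {k : ℕ} {p : Fin k → ℝ}
    {τ : Fin k → Matrix a a ℂ} (hp : ∀ x, 0 ≤ p x) (hτ : ∀ x, (τ x).PosSemidef) :
    (cqOperator p τ).PosSemidef := by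
  refine Matrix.posSemidef_sum _ fun x _ => Matrix.PosSemidef.smul ?_ ?_
  · refine Matrix.PosSemidef.kronecker ?_ (hτ x)
    rw [← Matrix.diagonal_single]
    exact Matrix.PosSemidef.diagonal (by
      intro i; by_cases h : i = x <;> simp [h])
  · exact_mod_cast hp x

theorem isDensity_cqOperator {a : Type u} [Fintype a] {k : ℕ} {p : Fin k → ℝ}
    {τ : Fin k → Matrix a a ℂ} (hp : ∀ x, 0 ≤ p x) (hp1 : ∑ x, p x = 1)
    (hτ : ∀ x, IsDensity (τ x)) : IsDensity (cqOperator p τ) := by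
  refine ⟨posSemidef_cqOperator hp fun x => (hτ x).1, ?_⟩
  simp only [Matrix.trace, Matrix.diag, Fintype.sum_prod_type, cqOperator_apply, if_true,
    ← Finset.mul_sum]
  have : ∀ x, ∑ i, τ x i i = 1 := fun x => (hτ x).2
  simp only [this, mul_one]
  exact_mod_cast hp1

section

variable {D : OperatorFunctional.{u}}

theorem IsQuantumDivergence.submatrix_le (hD : IsQuantumDivergence D) {a b : Type u} [Fintype a]
    [Fintype b] (f : b ≃ a) {ρ σ : Matrix a a ℂ} (hρ : IsDensity ρ) (hσ : σ.PosSemidef) :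
    D b (ρ.submatrix f f) (σ.submatrix f f) ≤ D a ρ σ :=
  hD.data_processing a b _ (isCPTP_submatrixMap f) ρ σ hρ hσ

theorem IsDensity.submatrix {a b : Type*} [Fintype a] [Fintype b] {ρ : Matrix a a ℂ}
    (hρ : IsDensity ρ) (f : b ≃ a) : IsDensity (ρ.submatrix f f) :=
  ⟨hρ.1.submatrix f, (Equiv.sum_comp f fun i => ρ i i).trans hρ.2⟩

/-- A divergence is invariant under relabelling of the basis: data processing applies in both
directions. -/
theorem IsQuantumDivergence.submatrix_eq (hD : IsQuantumDivergence D) {a b : Type u} [Fintype a]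
    [Fintype b] (f : b ≃ a) {ρ σ : Matrix a a ℂ} (hρ : IsDensity ρ) (hσ : σ.PosSemidef) :
    D b (ρ.submatrix f f) (σ.submatrix f f) = D a ρ σ := by
  refine le_antisymm (hD.submatrix_le f hρ hσ) ?_
  have := hD.submatrix_le f.symm (hρ.submatrix f) (hσ.submatrix f)
  simpa using this

theorem IsQuantumDivergence.krausMap_le (hD : IsQuantumDivergence D) {a b : Type u} [Fintype a]
    [Fintype b] [DecidableEq a] {J : Type*} [Fintype J] {K : J → Matrix b a ℂ}
    (hK : ∑ j, (K j).conjTranspose * K j = 1) {ρ σ : Matrix a a ℂ} (hρ : IsDensity ρ)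
    (hσ : σ.PosSemidef) : D b (krausMap K ρ) (krausMap K σ) ≤ D a ρ σ :=
  hD.data_processing a b _ (isCPTP_krausMap K hK) ρ σ hρ hσ

/-- Joint convexity: the direct-sum property evaluates the divergence of the classical-quantum
operators, and discarding the classical register cannot increase it. -/
theorem IsQuantumDivergence.apply_sum_le (hD : IsQuantumDivergence D)
    (hsum : HasDirectSumProperty D)
    {a : Type u} [Fintype a] {k : ℕ} {p : Fin k → ℝ} {ρ σ : Fin k → Matrix a a ℂ}
    (hp : ∀ x, 0 ≤ p x) (hp1 : ∑ x, p x = 1) (hρ : ∀ x, IsDensity (ρ x))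
    (hσ : ∀ x, (σ x).PosSemidef) :
    D a (∑ x, (p x : ℂ) • ρ x) (∑ x, (p x : ℂ) • σ x) ≤ ∑ x, (p x : EReal) * D a (ρ x) (σ x) := by
  rw [← hsum a k p ρ σ hp hp1 hρ hσ, ← partialTrace_cqOperator, ← partialTrace_cqOperator]
  exact hD.data_processing _ _ _ (isCPTP_partialTrace (Fin k)) _ _
    (isDensity_cqOperator hp hp1 hρ) (posSemidef_cqOperator hp hσ)

end

/-! ### Inputs with a classical reference -/

/-- The regrouping of `A ⊗ (C ⊗ R)` as `C ⊗ (A ⊗ R)`. -/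
def flagEquiv (a : Type u) (c : Type v) (r : Type w) : a × (c × r) ≃ c × (a × r) where
  toFun i := (i.2.1, (i.1, i.2.2))
  invFun i := (i.2.1, (i.1, i.2.2))
  left_inv _ := rfl
  right_inv _ := rfl

/-- The state `∑ x, p(x) |x⟩⟨x| ⊗ ρ x` of `A ⊗ (C ⊗ R)`, whose reference `C ⊗ R` contains a
classical register `C` that records which of the states `ρ x` of `A ⊗ R` was prepared. -/
noncomputable def flaggedState {a : Type u} {r : Type w} {k : ℕ} (p : Fin k → ℝ)
    (ρ : Fin k → Matrix (a × r) (a × r) ℂ) : Matrix (a × (Fin k × r)) (a × (Fin k × r)) ℂ :=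
  (cqOperator p ρ).submatrix (flagEquiv a (Fin k) r) (flagEquiv a (Fin k) r)

theorem isDensity_flaggedState {a : Type u} {r : Type w} [Fintype a] [Fintype r] {k : ℕ}
    {p : Fin k → ℝ} {ρ : Fin k → Matrix (a × r) (a × r) ℂ} (hp : ∀ x, 0 ≤ p x)
    (hp1 : ∑ x, p x = 1) (hρ : ∀ x, IsDensity (ρ x)) : IsDensity (flaggedState p ρ) :=
  (isDensity_cqOperator hp hp1 hρ).submatrix _

theorem marginal_flaggedState {a : Type u} {r : Type w} [Fintype r] {k : ℕ}
    (p : Fin k → ℝ) (ρ : Fin k → Matrix (a × r) (a × r) ℂ) :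
    marginal (flaggedState p ρ) = ∑ x, (p x : ℂ) • marginal (ρ x) := by
  ext i j
  simp [marginal, flaggedState, cqOperator_apply, flagEquiv, Fintype.sum_prod_type,
    Matrix.sum_apply, Finset.mul_sum]

theorem jammedOutput_flaggedState {a e b : Type u} {r : Type w} {k : ℕ}
    (N : Matrix (a × e) (a × e) ℂ →ₗ[ℂ] Matrix b b ℂ) (p : Fin k → ℝ)
    (ρ : Fin k → Matrix (a × r) (a × r) ℂ) (σ : Matrix e e ℂ) :
    jammedOutput N (flaggedState p ρ) σ = flaggedState p fun x => jammedOutput N (ρ x) σ := by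
  ext ⟨i, x, k⟩ ⟨j, y, l⟩
  simp only [jammedOutput_apply, flaggedState, Matrix.submatrix_apply, cqOperator_apply,
    flagEquiv, Equiv.coe_fn_mk]
  by_cases h : x = y
  · simp only [h, if_true]
    have : (Matrix.of fun p' q : a × e => (p y : ℂ) * ρ y (p'.1, k) (q.1, l) * σ p'.2 q.2) =
        (p y : ℂ) • Matrix.of fun p' q : a × e => ρ y (p'.1, k) (q.1, l) * σ p'.2 q.2 := by
      ext p' q
      simp [mul_assoc]
    rw [this, map_smul, Matrix.smul_apply, smul_eq_mul]
  · simp only [h, if_false, zero_mul]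
    exact congrFun (congrFun (map_zero N) i) j

theorem isDensity_marginal {a : Type u} {r : Type w} [Fintype a] [Fintype r]
    {ρ : Matrix (a × r) (a × r) ℂ} (hρ : IsDensity ρ) : IsDensity (marginal ρ) := by
  constructor
  · have : marginal ρ = ∑ k, ρ.submatrix (fun i => (i, k)) (fun i => (i, k)) := by
      ext i j
      simp [marginal, Matrix.sum_apply]
    rw [this]
    exact Matrix.posSemidef_sum _ fun k _ => hρ.1.submatrix _
  · rw [← hρ.2]
    simp [Matrix.trace, marginal, Fintype.sum_prod_type]

theorem IsPurification.isDensity_ketbra {a : Type u} {r : Type w} [Fintype a] [Fintype r]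
    {ψ : a × r → ℂ} {ρ : Matrix a a ℂ} (h : IsPurification ψ ρ) (hρ : IsDensity ρ) :
    IsDensity (ketbra ψ) := by
  refine ⟨Matrix.posSemidef_vecMulVec_self_star ψ, ?_⟩
  rw [← hρ.2]
  simp only [Matrix.trace, Matrix.diag, Fintype.sum_prod_type]
  exact Finset.sum_congr rfl fun i _ => h i i

theorem posSemidef_sum_smul {ι : Type*} [Fintype ι] {a : Type*} [Fintype a] {p : ι → ℝ}
    {τ : ι → Matrix a a ℂ} (hp : ∀ x, 0 ≤ p x) (hτ : ∀ x, (τ x).PosSemidef) :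
    (∑ x, (p x : ℂ) • τ x).PosSemidef :=
  Matrix.posSemidef_sum _ fun x _ => (hτ x).smul (by exact_mod_cast hp x)

theorem isDensity_sum_smul {ι : Type*} [Fintype ι] {a : Type*} [Fintype a] {p : ι → ℝ}
    {τ : ι → Matrix a a ℂ} (hp : ∀ x, 0 ≤ p x) (hp1 : ∑ x, p x = 1)
    (hτ : ∀ x, IsDensity (τ x)) : IsDensity (∑ x, (p x : ℂ) • τ x) := by
  refine ⟨posSemidef_sum_smul hp fun x => (hτ x).1, ?_⟩
  simp only [Matrix.trace_sum, Matrix.trace_smul, (hτ _).2, smul_eq_mul, mul_one]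
  exact_mod_cast hp1

/-! ### Compactness -/

theorem exists_eq_conjTranspose_mul_self {a : Type*} [Fintype a] {ρ : Matrix a a ℂ}
    (hρ : ρ.PosSemidef) : ∃ B : Matrix a a ℂ, ρ = B.conjTranspose * B := by
  classical
  open scoped MatrixOrder Matrix.Norms.L2Operator in
  exact CStarAlgebra.nonneg_iff_eq_star_mul_self.mp hρ.nonneg

/-- The density operators are the image of the compact set of the `B` of Hilbert–Schmidt norm one
under `B ↦ Bᴴ B`. -/
theorem isCompact_setOf_isDensity (a : Type*) [Fintype a] :
    IsCompact {ρ : Matrix a a ℂ | IsDensity ρ} := by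
  classical
  set S : Set (Matrix a a ℂ) := {B | (B.conjTranspose * B).trace = 1} with hS
  have htr : ∀ B : Matrix a a ℂ, (B.conjTranspose * B).trace =
      ((∑ i, ∑ j, ‖B j i‖ ^ 2 : ℝ) : ℂ) := by
    intro B
    simp only [Matrix.trace, Matrix.diag, Matrix.mul_apply, Matrix.conjTranspose_apply]
    push_cast
    exact Finset.sum_congr rfl fun i _ => Finset.sum_congr rfl fun j _ =>
      Complex.conj_mul' (B j i)
  have hSc : IsCompact S := by
    have hK : IsCompact (Set.univ.pi fun _ : a => Set.univ.pi fun _ : a =>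
        Metric.closedBall (0 : ℂ) 1) :=
      isCompact_univ_pi fun _ => isCompact_univ_pi fun _ => isCompact_closedBall 0 1
    refine hK.of_isClosed_subset (isClosed_eq (by fun_prop) continuous_const) ?_
    intro (B : Matrix a a ℂ) hB i _ j _
    have h1 : ∑ i, ∑ j, ‖B j i‖ ^ 2 = 1 := by
      have : (B.conjTranspose * B).trace = 1 := hB
      rw [htr] at this
      exact_mod_cast this
    have h2 : ‖B i j‖ ^ 2 ≤ 1 := by
      rw [← h1]
      refine (Finset.single_le_sum (f := fun i => ‖B i j‖ ^ 2) (fun _ _ => by positivity)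
        (Finset.mem_univ i)).trans ?_
      exact Finset.single_le_sum (f := fun j => ∑ i, ‖B i j‖ ^ 2)
        (fun _ _ => Finset.sum_nonneg fun _ _ => by positivity) (Finset.mem_univ j)
    rw [mem_closedBall_zero_iff]
    nlinarith [norm_nonneg (B i j)]
  have himg : {ρ : Matrix a a ℂ | IsDensity ρ} =
      (fun B : Matrix a a ℂ => B.conjTranspose * B) '' S := by
    ext ρ
    constructor
    · rintro ⟨h, ht⟩
      obtain ⟨B, rfl⟩ := exists_eq_conjTranspose_mul_self h
      exact ⟨B, ht, rfl⟩
    · rintro ⟨B, hB, rfl⟩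
      exact ⟨Matrix.posSemidef_conjTranspose_mul_self B, hB⟩
  rw [himg]
  exact hSc.image (by fun_prop)

theorem compactSpace_density (a : Type u) [Fintype a] : CompactSpace (Density a) :=
  isCompact_iff_compactSpace.1 (isCompact_setOf_isDensity a)

theorem compactSpace_permDensity (a : Type u) [Fintype a] (n : ℕ) :
    CompactSpace (PermDensity a n) := by
  have := compactSpace_density (Fin n → a)
  have hcl : IsClosed {ρ : Density (Fin n → a) | IsPermInvariant ρ.1} := by
    simp only [IsPermInvariant, Set.ofPred_forall]
    exact isClosed_iInter fun π => isClosed_eq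
      (continuous_subtype_val.matrix_submatrix _ _) continuous_subtype_val
  exact isCompact_iff_compactSpace.1 hcl.isCompact

theorem nonempty_density (a : Type u) [Fintype a] [Nonempty a] : Nonempty (Density a) := by
  classical
  obtain ⟨i⟩ := ‹Nonempty a›
  refine ⟨⟨Matrix.diagonal (Pi.single i 1), Matrix.PosSemidef.diagonal ?_, ?_⟩⟩
  · intro j
    by_cases h : j = i <;> simp [h]
  · simp [Matrix.trace_diagonal]

theorem isPermInvariant_sum_smul {ι : Type*} [Fintype ι] {a : Type u} {n : ℕ} (p : ι → ℂ)
    {τ : ι → Matrix (Fin n → a) (Fin n → a) ℂ} (hτ : ∀ x, IsPermInvariant (τ x)) :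
    IsPermInvariant (∑ x, p x • τ x) := by
  intro π
  ext i j
  have h : ∀ x, τ x (i ∘ π) (j ∘ π) = τ x i j := fun x => congrFun (congrFun (hτ x π) i) j
  simp [Matrix.sum_apply, h]

/-! ### Divergences of jammed outputs -/

/-- The divergence `D(N(ρ_{AR} ⊗ σ_E) ‖ M(ρ_{AR} ⊗ ω_E))` whose minimax value is `minimaxDiv`.
References live in the universe of the other systems; `iInf_jammedDiv_le_minimaxDiv` and
`minimaxDiv_le` translate to and from the references `Fin k`. -/
noncomputable def jammedDiv (D : OperatorFunctional.{u}) {a e b r : Type u} [Fintype b] [Fintype r]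
    (N M : Matrix (a × e) (a × e) ℂ →ₗ[ℂ] Matrix b b ℂ) (ρ : Matrix (a × r) (a × r) ℂ)
    (σ ω : Matrix e e ℂ) : EReal :=
  D (b × r) (jammedOutput N ρ σ) (jammedOutput M ρ ω)

section

variable {D : OperatorFunctional.{u}} {a e b r s : Type u} [Fintype a] [Fintype e] [Fintype b]
  [Fintype r] [Fintype s] {N M : Matrix (a × e) (a × e) ℂ →ₗ[ℂ] Matrix b b ℂ}

theorem jammedDiv_flaggedState (hD : IsQuantumDivergence D) (hsum : HasDirectSumProperty D)
    (hN : IsCPTP N) (hM : IsCP M) {k : ℕ} {p : Fin k → ℝ}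
    {ρ : Fin k → Matrix (a × r) (a × r) ℂ} (hp : ∀ x, 0 ≤ p x) (hp1 : ∑ x, p x = 1)
    (hρ : ∀ x, IsDensity (ρ x)) {σ ω : Matrix e e ℂ} (hσ : IsDensity σ) (hω : IsDensity ω) :
    jammedDiv D N M (flaggedState p ρ) σ ω = ∑ x, (p x : EReal) * jammedDiv D N M (ρ x) σ ω := by
  have h₁ : ∀ x, IsDensity (jammedOutput N (ρ x) σ) := fun x => isDensity_jammedOutput hN (hρ x) hσ
  have h₂ : ∀ x, (jammedOutput M (ρ x) ω).PosSemidef := fun x =>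
    posSemidef_jammedOutput hM (hρ x).1 hω.1
  unfold jammedDiv
  rw [jammedOutput_flaggedState, jammedOutput_flaggedState, ← hsum (b × r) k p _ _ hp hp1 h₁ h₂]
  exact hD.submatrix_eq _ (isDensity_cqOperator hp hp1 h₁) (posSemidef_cqOperator hp h₂)

/-- Among all inputs with a given marginal on `A`, the purifications have the largest divergence. -/
theorem jammedDiv_le_purification (hD : IsQuantumDivergence D)
    (hN : IsCPTP N) (hM : IsCP M) {ρ : Matrix (a × r) (a × r) ℂ} (hρ : IsDensity ρ)
    {ψ : a × s → ℂ} (hψ : IsPurification ψ (marginal ρ)) {σ ω : Matrix e e ℂ}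
    (hσ : IsDensity σ) (hω : IsDensity ω) :
    jammedDiv D N M ρ σ ω ≤ jammedDiv D N M (ketbra ψ) σ ω := by
  classical
  have : Nonempty r := by
    by_contra h
    have := not_nonempty_iff.1 h
    simpa [Matrix.trace] using hρ.2
  obtain ⟨m, K, hK, hKψ⟩ := exists_krausMap_purification ψ hρ.1 hψ
  have hψd := hψ.isDensity_ketbra (isDensity_marginal hρ)
  unfold jammedDiv
  rw [← hKψ, jammedOutput_krausMap, jammedOutput_krausMap]
  refine hD.krausMap_le ?_ (isDensity_jammedOutput hN hψd hσ)
    (posSemidef_jammedOutput hM hψd.1 hω.1)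
  simp_rw [Matrix.conjTranspose_kronecker, ← Matrix.mul_kronecker_mul, Matrix.conjTranspose_one,
    Matrix.one_mul]
  have : ∑ j, (1 : Matrix b b ℂ) ⊗ₖ ((K j).conjTranspose * K j) =
      (1 : Matrix b b ℂ) ⊗ₖ ∑ j, ((K j).conjTranspose * K j) := by
    ext i j
    simp only [Matrix.sum_apply, Matrix.kroneckerMap_apply, Finset.mul_sum]
  rw [this, hK, Matrix.one_kronecker_one]

theorem jammedDiv_sum_le (hD : IsQuantumDivergence D) (hsum : HasDirectSumProperty D)
    (hN : IsCPTP N) (hM : IsCP M) {ρ : Matrix (a × r) (a × r) ℂ} (hρ : IsDensity ρ)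
    {k : ℕ} {p : Fin k → ℝ} {σ ω : Fin k → Matrix e e ℂ} (hp : ∀ x, 0 ≤ p x)
    (hp1 : ∑ x, p x = 1) (hσ : ∀ x, IsDensity (σ x)) (hω : ∀ x, IsDensity (ω x)) :
    jammedDiv D N M ρ (∑ x, (p x : ℂ) • σ x) (∑ x, (p x : ℂ) • ω x) ≤
      ∑ x, (p x : EReal) * jammedDiv D N M ρ (σ x) (ω x) := by
  unfold jammedDiv
  rw [jammedOutput_sum, jammedOutput_sum]
  exact hD.apply_sum_le hsum hp hp1 (fun x => isDensity_jammedOutput hN hρ (hσ x))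
    fun x => posSemidef_jammedOutput hM hρ.1 (hω x).1

theorem jammedDiv_ne_bot (hD : IsQuantumDivergence D) (hN : IsCPTP N) (hM : IsCP M)
    {ρ : Matrix (a × r) (a × r) ℂ} (hρ : IsDensity ρ) {σ ω : Matrix e e ℂ}
    (hσ : IsDensity σ) (hω : IsDensity ω) : jammedDiv D N M ρ σ ω ≠ ⊥ :=
  hD.ne_bot _ _ _ (isDensity_jammedOutput hN hρ hσ) (posSemidef_jammedOutput hM hρ.1 hω.1)

theorem lowerSemicontinuousOn_jammedDiv (hlsc : IsLowerSemicontinuous D) (hN : IsCPTP N)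
    (hM : IsCP M) {ρ : Matrix (a × r) (a × r) ℂ} (hρ : IsDensity ρ) :
    LowerSemicontinuousOn (fun p : Matrix e e ℂ × Matrix e e ℂ => jammedDiv D N M ρ p.1 p.2)
      {p | IsDensity p.1 ∧ IsDensity p.2} :=
  (hlsc (b × r)).comp (g := fun p : Matrix e e ℂ × Matrix e e ℂ =>
      (jammedOutput N ρ p.1, jammedOutput M ρ p.2))
    (((continuous_jammedOutput N ρ).comp continuous_fst).prodMk
      ((continuous_jammedOutput M ρ).comp continuous_snd)).continuousOn
    fun _ hp => ⟨isDensity_jammedOutput hN hρ hp.1, posSemidef_jammedOutput hM hρ.1 hp.2.1⟩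

theorem iInf_jammedDiv_le_minimaxDiv (hD : IsQuantumDivergence D) (hN : IsCPTP N) (hM : IsCP M)
    {ρ : Matrix (a × r) (a × r) ℂ} (hρ : IsDensity ρ) :
    ⨅ (σ : Density e) (ω : Density e), jammedDiv D N M ρ σ.1 ω.1 ≤ minimaxDiv D N M := by
  let f : Fin (Fintype.card r) ≃ r := (Fintype.equivFin r).symm
  let g : ∀ c : Type u, c × Fin (Fintype.card r) ≃ c × r := fun c =>
    Equiv.prodCongr (Equiv.refl c) f
  refine le_iSup_of_le (Fintype.card r) (le_iSup_of_le ⟨ρ.submatrix (g a) (g a), hρ.submatrix _⟩ ?_)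
  refine iInf_mono fun σ => iInf_mono fun ω => ?_
  exact (hD.submatrix_eq (g b) (isDensity_jammedOutput hN hρ σ.2)
    (posSemidef_jammedOutput hM hρ.1 ω.2.1)).ge

theorem minimaxDiv_le (hD : IsQuantumDivergence D) (hN : IsCPTP N) (hM : IsCP M) {C : EReal}
    (h : ∀ (r : Type u) [Fintype r] (ρ : Matrix (a × r) (a × r) ℂ), IsDensity ρ →
      ⨅ (σ : Density e) (ω : Density e), jammedDiv D N M ρ σ.1 ω.1 ≤ C) :
    minimaxDiv D N M ≤ C := by
  refine iSup_le fun k => iSup_le fun ρ => ?_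
  let g : ∀ c : Type u, c × ULift.{u} (Fin k) ≃ c × Fin k := fun c =>
    Equiv.prodCongr (Equiv.refl c) Equiv.ulift
  refine le_trans ?_ (h (ULift.{u} (Fin k)) (ρ.1.submatrix (g a) (g a)) (ρ.2.submatrix _))
  refine iInf_mono fun σ => iInf_mono fun ω => ?_
  exact (hD.submatrix_eq (g b) (isDensity_jammedOutput hN ρ.2 σ.2)
    (posSemidef_jammedOutput hM ρ.2.1 ω.2.1)).ge

end

/-! ### Permutations -/

/-- Conjugation with the unitary that permutes the `n` tensor factors according to `π`. -/
def permConj {a : Type*} {n : ℕ} (π : Equiv.Perm (Fin n)) (σ : Matrix (Fin n → a) (Fin n → a) ℂ) :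
    Matrix (Fin n → a) (Fin n → a) ℂ :=
  σ.submatrix (fun s => s ∘ π) (fun s => s ∘ π)

theorem permConj_permConj {a : Type*} {n : ℕ} (π τ : Equiv.Perm (Fin n))
    (σ : Matrix (Fin n → a) (Fin n → a) ℂ) : permConj π (permConj τ σ) = permConj (π * τ) σ := rfl

theorem permConj_permConj_inv {a : Type*} {n : ℕ} (π : Equiv.Perm (Fin n))
    (σ : Matrix (Fin n → a) (Fin n → a) ℂ) : permConj π (permConj π⁻¹ σ) = σ := by
  rw [permConj_permConj, mul_inv_cancel]
  rfl

/-- The permutation of the copies of `A` in `A^n ⊗ R`, as a relabelling of the basis. -/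
def permInput {a : Type*} {r : Type*} {n : ℕ} (π : Equiv.Perm (Fin n)) :
    (Fin n → a) × r ≃ (Fin n → a) × r :=
  (Equiv.arrowCongr π.symm (Equiv.refl a)).prodCongr (Equiv.refl r)

theorem isDensity_permConj {a : Type*} [Fintype a] {n : ℕ} (π : Equiv.Perm (Fin n))
    {σ : Matrix (Fin n → a) (Fin n → a) ℂ} (hσ : IsDensity σ) : IsDensity (permConj π σ) :=
  hσ.submatrix (Equiv.arrowCongr π.symm (Equiv.refl a))

/-- The weight `1 / n!` of the uniform distribution on the permutations. -/
noncomputable def permWeight (n : ℕ) : ℝ := (Fintype.card (Equiv.Perm (Fin n)) : ℝ)⁻¹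

theorem permWeight_nonneg (n : ℕ) : 0 ≤ permWeight n := by unfold permWeight; positivity

theorem sum_permWeight (n : ℕ) :
    ∑ _x : Fin (Fintype.card (Equiv.Perm (Fin n))), permWeight n = 1 := by
  have : (Fintype.card (Equiv.Perm (Fin n)) : ℝ) ≠ 0 := by
    exact_mod_cast Fintype.card_ne_zero
  simp only [Finset.sum_const, Finset.card_univ, Fintype.card_fin, nsmul_eq_mul, permWeight]
  exact mul_inv_cancel₀ this

/-- The average of `σ` over all permutations of the tensor factors. -/
noncomputable def symmetrize {a : Type*} {n : ℕ} (σ : Matrix (Fin n → a) (Fin n → a) ℂ) :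
    Matrix (Fin n → a) (Fin n → a) ℂ :=
  ∑ π : Equiv.Perm (Fin n), (permWeight n : ℂ) • permConj π σ

theorem isPermInvariant_symmetrize {a : Type u} {n : ℕ} (σ : Matrix (Fin n → a) (Fin n → a) ℂ) :
    IsPermInvariant (symmetrize σ) := by
  intro π
  have h : permConj π (symmetrize σ) = ∑ τ, (permWeight n : ℂ) • permConj (π * τ) σ := by
    ext i j
    simp [permConj, symmetrize, Matrix.sum_apply, Function.comp_assoc]
  exact h.trans (Equiv.sum_comp (Equiv.mulLeft π) fun τ => (permWeight n : ℂ) • permConj τ σ)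

/-- An enumeration of the permutations, as the direct-sum property speaks of outcomes in `Fin k`. -/
noncomputable def permEnum (n : ℕ) :
    Fin (Fintype.card (Equiv.Perm (Fin n))) ≃ Equiv.Perm (Fin n) :=
  (Fintype.equivFin _).symm

theorem symmetrize_eq_sum_permEnum {a : Type*} {n : ℕ} (σ : Matrix (Fin n → a) (Fin n → a) ℂ) :
    symmetrize σ = ∑ x, (permWeight n : ℂ) • permConj (permEnum n x) σ :=
  (Equiv.sum_comp (permEnum n) fun τ => (permWeight n : ℂ) • permConj τ σ).symm

theorem symmetrize_eq_sum_permEnum_inv {a : Type*} {n : ℕ}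
    (σ : Matrix (Fin n → a) (Fin n → a) ℂ) :
    symmetrize σ = ∑ x, (permWeight n : ℂ) • permConj (permEnum n x)⁻¹ σ :=
  (Equiv.sum_comp ((permEnum n).trans (Equiv.inv _))
    fun τ => (permWeight n : ℂ) • permConj τ σ).symm

theorem isDensity_symmetrize {a : Type*} [Fintype a] {n : ℕ}
    {σ : Matrix (Fin n → a) (Fin n → a) ℂ} (hσ : IsDensity σ) : IsDensity (symmetrize σ) := by
  rw [symmetrize_eq_sum_permEnum]
  exact isDensity_sum_smul (p := fun _ => permWeight n) (fun _ => permWeight_nonneg n)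
    (sum_permWeight n) fun x => isDensity_permConj _ hσ

/-- The input obtained from `ρ` by permuting the copies of `A` uniformly at random and recording the
permutation in the reference. -/
noncomputable def permFlagged {a : Type*} {r : Type*} {n : ℕ}
    (ρ : Matrix ((Fin n → a) × r) ((Fin n → a) × r) ℂ) :=
  flaggedState (fun _ => permWeight n)
    fun x => ρ.submatrix (permInput (permEnum n x)) (permInput (permEnum n x))

theorem isDensity_permFlagged {a : Type u} {r : Type w} [Fintype a] [Fintype r] {n : ℕ}
    {ρ : Matrix ((Fin n → a) × r) ((Fin n → a) × r) ℂ} (hρ : IsDensity ρ) :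
    IsDensity (permFlagged ρ) :=
  isDensity_flaggedState (fun _ => permWeight_nonneg n) (sum_permWeight n)
    fun x => hρ.submatrix (permInput (permEnum n x))

theorem marginal_permFlagged {a : Type u} {r : Type w} [Fintype r] {n : ℕ}
    (ρ : Matrix ((Fin n → a) × r) ((Fin n → a) × r) ℂ) :
    marginal (permFlagged ρ) = symmetrize (marginal ρ) := by
  rw [symmetrize_eq_sum_permEnum]
  exact marginal_flaggedState _ _

section

variable {D : OperatorFunctional.{u}} {a e b r : Type u} [Fintype a] [Fintype e] [Fintype b]
  [Fintype r] [DecidableEq a] [DecidableEq e]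
  {N M : Matrix (a × e) (a × e) ℂ →ₗ[ℂ] Matrix b b ℂ} {n : ℕ}

theorem jammedDiv_permInput (hD : IsQuantumDivergence D) (hN : IsCPTP N) (hM : IsCP M)
    {ρ : Matrix ((Fin n → a) × r) ((Fin n → a) × r) ℂ} (hρ : IsDensity ρ)
    {σ ω : Matrix (Fin n → e) (Fin n → e) ℂ} (hσ : IsDensity σ) (hω : IsDensity ω)
    (π : Equiv.Perm (Fin n)) :
    jammedDiv D (tensorPower n N) (tensorPower n M)
      (ρ.submatrix (permInput π) (permInput π)) (permConj π σ) (permConj π ω) =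
    jammedDiv D (tensorPower n N) (tensorPower n M) ρ σ ω := by
  have h₁ := jammedOutput_tensorPower_perm N π ρ σ
  have h₂ := jammedOutput_tensorPower_perm M π ρ ω
  refine Eq.trans (congrArg₂ (D ((Fin n → b) × r)) h₁ h₂) ?_
  exact hD.submatrix_eq (permInput π) (isDensity_jammedOutput (isCPTP_tensorPower hN) hρ hσ)
    (posSemidef_jammedOutput (isCP_tensorPower hM) hρ.1 hω.1)

/-- The state `permFlagged ρ` forces the jammer to act symmetrically: against it, jammer states
`σ`, `ω` achieve at best what their symmetrizations achieve against `ρ`. By covariance each recorded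
permutation of the input can be moved onto the jammer states, and joint convexity applies. -/
theorem jammedDiv_symmetrize_le (hD : IsQuantumDivergence D) (hsum : HasDirectSumProperty D)
    (hN : IsCPTP N) (hM : IsCP M)
    {ρ : Matrix ((Fin n → a) × r) ((Fin n → a) × r) ℂ} (hρ : IsDensity ρ)
    {σ ω : Matrix (Fin n → e) (Fin n → e) ℂ} (hσ : IsDensity σ) (hω : IsDensity ω) :
    jammedDiv D (tensorPower n N) (tensorPower n M) ρ (symmetrize σ) (symmetrize ω) ≤
      jammedDiv D (tensorPower n N) (tensorPower n M) (permFlagged ρ) σ ω := by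
  have hN' := isCPTP_tensorPower (n := n) hN
  have hM' := isCP_tensorPower (n := n) hM
  rw [symmetrize_eq_sum_permEnum_inv σ, symmetrize_eq_sum_permEnum_inv ω]
  refine (jammedDiv_sum_le (p := fun _ => permWeight n) hD hsum hN' hM' hρ
    (fun _ => permWeight_nonneg n) (sum_permWeight n) (fun x => isDensity_permConj _ hσ)
    fun x => isDensity_permConj _ hω).trans_eq ?_
  unfold permFlagged
  rw [jammedDiv_flaggedState hD hsum hN' hM' (fun _ => permWeight_nonneg n) (sum_permWeight n)
    (fun x => hρ.submatrix _) hσ hω]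
  refine Finset.sum_congr rfl fun x _ => ?_
  rw [← jammedDiv_permInput hD hN hM hρ (isDensity_permConj _ hσ) (isDensity_permConj _ hω)
    (permEnum n x), permConj_permConj_inv, permConj_permConj_inv]

theorem symmetrize_eq_self {a : Type u} {σ : Matrix (Fin n → a) (Fin n → a) ℂ}
    (h : IsPermInvariant σ) : symmetrize σ = σ := by
  have h' : ∀ π, permConj π σ = σ := h
  rw [symmetrize_eq_sum_permEnum]
  simp_rw [h', ← Finset.sum_smul]
  have := sum_permWeight n
  rw [← Complex.ofReal_sum, this, Complex.ofReal_one, one_smul]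

end

/-! ### The minimax exchange -/

section

variable {D : OperatorFunctional.{u}} {a e b r : Type u} [Fintype a] [Fintype e] [Fintype b]
  [Fintype r] {n : ℕ}
  {N M : Matrix (a × (Fin n → e)) (a × (Fin n → e)) ℂ →ₗ[ℂ] Matrix b b ℂ}

theorem PermDensity.exists_eq_add (σ σ' : PermDensity e n) {s t : ℝ} (hs : 0 ≤ s) (ht : 0 ≤ t)
    (hst : s + t = 1) :
    ∃ τ : PermDensity e n, τ.1.1 = (s : ℂ) • σ.1.1 + (t : ℂ) • σ'.1.1 := by
  have hp : ∀ i, 0 ≤ ![s, t] i := by simp [Fin.forall_fin_two, hs, ht]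
  have hd : IsDensity (∑ i : Fin 2, ((![s, t] i : ℝ) : ℂ) • ![σ.1.1, σ'.1.1] i) :=
    isDensity_sum_smul hp (by simp [hst]) (by simp [Fin.forall_fin_two, σ.1.2, σ'.1.2])
  have hi : IsPermInvariant (∑ i : Fin 2, ((![s, t] i : ℝ) : ℂ) • ![σ.1.1, σ'.1.1] i) :=
    isPermInvariant_sum_smul _ (by simp [Fin.forall_fin_two, σ.2, σ'.2])
  exact ⟨⟨⟨_, hd⟩, hi⟩, by simp [Fin.sum_univ_two]⟩

theorem jammedDiv_add_le {e : Type u} [Fintype e]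
    {N M : Matrix (a × e) (a × e) ℂ →ₗ[ℂ] Matrix b b ℂ} (hD : IsQuantumDivergence D)
    (hsum : HasDirectSumProperty D)
    (hN : IsCPTP N) (hM : IsCP M) {ρ : Matrix (a × r) (a × r) ℂ} (hρ : IsDensity ρ)
    {σ σ' ω ω' : Matrix e e ℂ} (hσ : IsDensity σ) (hσ' : IsDensity σ') (hω : IsDensity ω)
    (hω' : IsDensity ω') {s t : ℝ} (hs : 0 ≤ s) (ht : 0 ≤ t) (hst : s + t = 1) :
    jammedDiv D N M ρ ((s : ℂ) • σ + (t : ℂ) • σ') ((s : ℂ) • ω + (t : ℂ) • ω') ≤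
      s * jammedDiv D N M ρ σ ω + t * jammedDiv D N M ρ σ' ω' := by
  have h := jammedDiv_sum_le (p := ![s, t]) (σ := ![σ, σ']) (ω := ![ω, ω']) hD hsum hN hM hρ
    (by simp [Fin.forall_fin_two, hs, ht]) (by simp [hst])
    (by simp [Fin.forall_fin_two, hσ, hσ']) (by simp [Fin.forall_fin_two, hω, hω'])
  simpa [Fin.sum_univ_two] using h

/-- The minimax exchange between permutation-invariant jammer states and input marginals.
Concavity in the input comes from flagging: the mixture of the inputs with marginals `ρ i`, recorded
in the reference, has as divergence the average, and is dominated by the purification of its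
marginal. -/
theorem iInf_iSup_jammedDiv_le_iSup_iInf [Nonempty a] (hD : IsQuantumDivergence D)
    (hlsc : IsLowerSemicontinuous D) (hsum : HasDirectSumProperty D) (hN : IsCPTP N) (hM : IsCP M)
    (ψ : Density a → a × r → ℂ) (hψ : ∀ ρ, IsPurification (ψ ρ) ρ.1) :
    ⨅ σω : PermDensity e n × PermDensity e n, ⨆ ρ,
        jammedDiv D N M (ketbra (ψ ρ)) σω.1.1.1 σω.2.1.1 ≤
      ⨆ ρ, ⨅ σω : PermDensity e n × PermDensity e n,
        jammedDiv D N M (ketbra (ψ ρ)) σω.1.1.1 σω.2.1.1 := by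
  have hψd : ∀ ρ, IsDensity (ketbra (ψ ρ)) := fun ρ => (hψ ρ).isDensity_ketbra ρ.2
  have := compactSpace_permDensity e n
  have := nonempty_density a
  refine iInf_iSup_le_iSup_iInf_of_convexlike
    (fun (σω : PermDensity e n × PermDensity e n) ρ =>
      jammedDiv D N M (ketbra (ψ ρ)) σω.1.1.1 σω.2.1.1)
    (fun σω ρ => jammedDiv_ne_bot hD hN hM (hψd ρ) σω.1.1.2 σω.2.1.2) (fun ρ => ?_) ?_ ?_
  · rw [← lowerSemicontinuousOn_univ_iff]
    exact (lowerSemicontinuousOn_jammedDiv hlsc hN hM (hψd ρ)).comp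
      (g := fun σω : PermDensity e n × PermDensity e n => (σω.1.1.1, σω.2.1.1))
      (by fun_prop) fun σω _ => ⟨σω.1.1.2, σω.2.1.2⟩
  · intro x x' s t hs ht hst
    obtain ⟨σ, hσ⟩ := PermDensity.exists_eq_add x.1 x'.1 hs ht hst
    obtain ⟨ω, hω⟩ := PermDensity.exists_eq_add x.2 x'.2 hs ht hst
    refine ⟨(σ, ω), fun ρ => ?_⟩
    rw [hσ, hω]
    exact jammedDiv_add_le hD hsum hN hM (hψd ρ) x.1.1.2 x'.1.1.2 x.2.1.2 x'.2.1.2 hs ht hst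
  · intro m p ρ hp hp1
    have hd := isDensity_flaggedState hp hp1 fun i => hψd (ρ i)
    refine ⟨⟨_, isDensity_marginal hd⟩, fun σω => ?_⟩
    refine (jammedDiv_flaggedState hD hsum hN hM hp hp1 (fun i => hψd (ρ i)) σω.1.1.2
      σω.2.1.2).symm.trans_le ?_
    exact jammedDiv_le_purification hD hN hM hd (hψ _) σω.1.1.2 σω.2.1.2

end

end QuantumJammer

open QuantumJammer
theorem mainTheorem5
    (D : OperatorFunctional.{u}) (hD : IsQuantumDivergence D)
    (hlsc : IsLowerSemicontinuous D) (hsum : HasDirectSumProperty D)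
    {a e b : Type u} [Fintype a] [Fintype e] [Fintype b] [DecidableEq a] [DecidableEq e]
    [Nonempty a] [Nonempty e] [Nonempty b]
    (N M : Matrix (a × e) (a × e) ℂ →ₗ[ℂ] Matrix b b ℂ) (hN : IsCPTP N) (hM : IsCP M)
    (n : ℕ) (hn : 2 ≤ n)
    (ψ : Density (Fin n → a) → (Fin n → a) × (Fin n → a) → ℂ)
    (hψ : ∀ ρ, IsPurification (ψ ρ) ρ.1) :
    minimaxDiv D (tensorPower n N) (tensorPower n M) =
        (⨅ (σ : PermDensity e n) (ω : PermDensity e n), ⨆ ρ : Density (Fin n → a),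
          D ((Fin n → b) × (Fin n → a))
            (jammedOutput (tensorPower n N) (ketbra (ψ ρ)) σ.1.1)
            (jammedOutput (tensorPower n M) (ketbra (ψ ρ)) ω.1.1)) ∧
      minimaxDiv D (tensorPower n N) (tensorPower n M) =
        (⨅ (σ : PermDensity e n) (ω : PermDensity e n), ⨆ ρ : PermDensity a n,
          D ((Fin n → b) × (Fin n → a))
            (jammedOutput (tensorPower n N) (ketbra (ψ ρ.1)) σ.1.1)
            (jammedOutput (tensorPower n M) (ketbra (ψ ρ.1)) ω.1.1)) := by
  have hN' := isCPTP_tensorPower (n := n) hN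
  have hM' := isCP_tensorPower (n := n) hM
  have hψd : ∀ ρ, IsDensity (ketbra (ψ ρ)) := fun ρ => (hψ ρ).isDensity_ketbra ρ.2
  set R₁ := ⨅ (σ : PermDensity e n) (ω : PermDensity e n), ⨆ ρ : Density (Fin n → a),
    D ((Fin n → b) × (Fin n → a))
      (jammedOutput (tensorPower n N) (ketbra (ψ ρ)) σ.1.1)
      (jammedOutput (tensorPower n M) (ketbra (ψ ρ)) ω.1.1) with hR₁
  set R₂ := ⨅ (σ : PermDensity e n) (ω : PermDensity e n), ⨆ ρ : PermDensity a n,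
    D ((Fin n → b) × (Fin n → a))
      (jammedOutput (tensorPower n N) (ketbra (ψ ρ.1)) σ.1.1)
      (jammedOutput (tensorPower n M) (ketbra (ψ ρ.1)) ω.1.1) with hR₂
  -- against permutation-invariant jammer states, inputs with permutation-invariant marginal suffice
  have h₂ : minimaxDiv D (tensorPower n N) (tensorPower n M) ≤ R₂ := by
    refine le_iInf fun σ => le_iInf fun ω => minimaxDiv_le hD hN' hM' fun r _ ρ hρ => ?_
    refine (iInf₂_le σ.1 ω.1).trans ?_
    have h := jammedDiv_symmetrize_le hD hsum hN hM hρ σ.1.2 ω.1.2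
    rw [symmetrize_eq_self σ.2, symmetrize_eq_self ω.2] at h
    have hρ' := isDensity_permFlagged hρ
    let ρ' : PermDensity a n := ⟨⟨marginal (permFlagged ρ), isDensity_marginal hρ'⟩, by
      change IsPermInvariant (marginal _)
      rw [marginal_permFlagged]
      exact isPermInvariant_symmetrize _⟩
    refine le_iSup_of_le ρ' (h.trans ?_)
    exact jammedDiv_le_purification hD hN' hM' hρ' (hψ ρ'.1) σ.1.2 ω.1.2
  have h₂₁ : R₂ ≤ R₁ := iInf_mono fun σ => iInf_mono fun ω =>
    iSup_le fun ρ => le_iSup_of_le ρ.1 le_rfl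
  -- exchange infimum and supremum, then let the input enforce symmetric jammer states
  have h₁ : R₁ ≤ minimaxDiv D (tensorPower n N) (tensorPower n M) := by
    have hmm := iInf_iSup_jammedDiv_le_iSup_iInf hD hlsc hsum hN' hM' ψ hψ
    rw [iInf_prod] at hmm
    refine hmm.trans (iSup_le fun ρ => ?_)
    refine le_trans ?_ (iInf_jammedDiv_le_minimaxDiv hD hN' hM' (isDensity_permFlagged (hψd ρ)))
    refine le_iInf fun σ => le_iInf fun ω => ?_
    refine le_trans ?_ (jammedDiv_symmetrize_le hD hsum hN hM (hψd ρ) σ.2 ω.2)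
    exact iInf_le_of_le (⟨⟨_, isDensity_symmetrize σ.2⟩, isPermInvariant_symmetrize _⟩,
      ⟨⟨_, isDensity_symmetrize ω.2⟩, isPermInvariant_symmetrize _⟩) le_rfl
  exact ⟨le_antisymm (h₂.trans h₂₁) h₁, le_antisymm h₂ (h₂₁.trans h₁)⟩
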